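/- Let $d\in\mathbb N$, let $M_d$ be the space of real $d\times d$ matrices, $S_d^+$ the cone of symmetric positive semidefinite and $S_d^{++}$ that of symmetric positive definite $d\times d$ matrices, and $\langle x,y\rangle=\operatorname{tr}(xy)$. For $p\ge 0$ and $\omega,\sigma\in S_d^+$, the non-central Wishart distribution $\Gamma(p,\omega;\sigma)$ is, whenever it exists, the probability measure on $S_d^+$ with Laplace transform $$\int_{S_d^+}e^{-\langle u,\xi\rangle}\,\Gamma(p,\omega;\sigma)(d\xi)=\det(I+\sigma u)^{-p}\,e^{-\operatorname{tr}\left(u(I+\sigma u)^{-1}\omega\right)},\qquad u\in S_d^+ ,$$ and $F(p,\omega,\sigma,\cdot)$ denotes its density with respect to Lebesgue measure on the symmetric $d\times d$ matrices, when it has one. A Wishart process with parameters $p\ge 0$, $\alpha\in S_d^+$, $\beta\in M_d$ is a stochastically continuous, time-homogeneous Markov process $(X,\mathbb P_x)_{x\in S_d^+}$ on $S_d^+$ such that $$\mathbb E_x\left[e^{-\langle u,X_t\rangle}\right]=e^{-\phi(t,u)-\langle\psi(t,u),x\rangle},\qquad t\ge 0,\ x,u\in S_d^+,$$ for functions $\phi:\mathbb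 R_+\times S_d^+\to\mathbb R$ and $\psi:\mathbb R_+\times S_d^+\to S_d^+$ that satisfy, with the dot denoting $\partial/\partial t$, $$\dot\phi(t,u)=2p\,\langle\alpha,\psi(t,u)\rangle,\quad \phi(0,u)=0,$$ $$\dot\psi(t,u)=-2\psi(t,u)\,\alpha\,\psi(t,u)+\psi(t,u)\beta+\beta^\top\psi(t,u),\quad \psi(0,u)=u .$$ For $t\ge0$ and $x\in S_d^+$ put $\omega^\beta_t(x)=e^{\beta t}xe^{\beta^\top t}$ and $\sigma_t^\beta(x)=2\int_0^t\omega^\beta_s(x)\,ds$. **Proposition.** Let $(X,\mathbb P_x)_{x\in S_d^+}$ be a Wishart process with parameters $(p,\alpha,\beta)$, and suppose that $\alpha\ne 0$. Then for all $t>0$ and $x\in S_d^+$ the law of $X_t$ under $\mathbb P_x$ is $\Gamma(p,\omega_t^\beta(x);\sigma_t^\beta(\alpha))$; in particular this distribution exists. If moreover $\alpha\in S_d^{++}$ and $p>\frac{d-1}{2}$, then for all $t>0$ and $x\in S_d^+$ the law of $X_t$ under $\mathbb P_x$ is absolutely continuous with respect to Lebesgue measure, with density $$f_t(x,\xi)=F(p,\omega_t^\beta(x),\sigma_t^\beta(\alpha),\xi).$$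 -/

import Mathlib

open MeasureTheory ProbabilityTheory
open scoped NNReal ENNReal Matrix

/-- The product σ-algebra on the space of real `d × d` matrices. -/
instance matrixMeasurableSpace (d : ℕ) : MeasurableSpace (Matrix (Fin d) (Fin d) ℝ) :=
  inferInstanceAs (MeasurableSpace (Fin d → Fin d → ℝ))

/-- The product σ-algebra on matrices is the Borel σ-algebra. -/
instance matrixBorelSpace (d : ℕ) : BorelSpace (Matrix (Fin d) (Fin d) ℝ) :=
  inferInstanceAs (BorelSpace (Fin d → Fin d → ℝ))

/-- The cone `S_d^+` of real symmetric positive semidefinite `d × d` matrices, with the topology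
and the (Borel) σ-algebra inherited from the space of all `d × d` matrices. -/
abbrev PSDCone (d : ℕ) : Type := {x : Matrix (Fin d) (Fin d) ℝ // x.PosSemidef}

/-- The pairing `⟨x, y⟩ = tr (x y)` on `S_d^+`. -/
def PSDCone.pairing {d : ℕ} (x y : PSDCone d) : ℝ := (x.1 * y.1).trace

/-- The linear isometry of the Euclidean space with coordinates `(v_{ij})_{i ≤ j}` onto the space
of symmetric `d × d` matrices with scalar product `tr (x y)`: diagonal entries are `v_{ii}`,
off-diagonal ones are `v_{ij} / √2`. -/
noncomputable def symmetricOfCoords (d : ℕ) (v : {q : Fin d × Fin d // q.1 ≤ q.2} → ℝ) :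
    Matrix (Fin d) (Fin d) ℝ :=
  Matrix.of fun i j =>
    if i = j then v ⟨(i, i), le_refl i⟩
    else v ⟨(min i j, max i j), min_le_max⟩ / √2

/-- Lebesgue measure on `S_d^+`: the Lebesgue measure of the Euclidean space of symmetric matrices
(with scalar product `tr (x y)`), restricted to the cone. -/
noncomputable def lebesgueCone (d : ℕ) : Measure (PSDCone d) :=
  ((volume : Measure ({q : Fin d × Fin d // q.1 ≤ q.2} → ℝ)).map
    (symmetricOfCoords d)).comap Subtype.val

/-- `μ` is a probability measure on `S_d^+` with the Laplace transform that defines the non-central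
Wishart distribution `Γ(p, ω; σ)`. -/
structure IsNoncentralWishart {d : ℕ} (p : ℝ) (ω σ : PSDCone d) (μ : Measure (PSDCone d)) :
    Prop where
  isProbabilityMeasure : IsProbabilityMeasure μ
  laplace : ∀ u : PSDCone d,
    ∫ ξ, Real.exp (-(u.pairing ξ)) ∂μ =
      (1 + σ.1 * u.1).det ^ (-p) * Real.exp (-(u.1 * (1 + σ.1 * u.1)⁻¹ * ω.1).trace)

open Classical in
/-- The non-central Wishart distribution `Γ(p, ω; σ)`, the probability measure given by its Laplace
transform (the zero measure if there is no such probability measure). -/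
noncomputable def noncentralWishart {d : ℕ} (p : ℝ) (ω σ : PSDCone d) : Measure (PSDCone d) :=
  if h : ∃ μ, IsNoncentralWishart p ω σ μ then h.choose else 0

/-- `F(p, ω, σ, ξ)`, the density of `Γ(p, ω; σ)` with respect to Lebesgue measure on `S_d^+`
(in general: the density of its absolutely continuous part). -/
noncomputable def wishartDensity {d : ℕ} (p : ℝ) (ω σ : PSDCone d) (ξ : PSDCone d) : ℝ≥0∞ :=
  (noncentralWishart p ω σ).rnDeriv (lebesgueCone d) ξ

/-- `(X, P_x)_{x ∈ S}` is a time-homogeneous Markov process with state space `S`, with respect to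
the filtration `ℱ`. -/
structure IsMarkovProcess {S Ω : Type*} [MeasurableSpace S] [mΩ : MeasurableSpace Ω]
    (ℱ : Filtration ℝ≥0 mΩ) (X : ℝ≥0 → Ω → S) (P : S → Measure Ω) : Prop where
  isProbabilityMeasure : ∀ x, IsProbabilityMeasure (P x)
  adapted : ∀ t, Measurable[ℱ t] (X t)
  start : ∀ x, ∀ᵐ ω ∂(P x), X 0 ω = x
  measurable_transition : ∀ (t : ℝ≥0) (A : Set S), MeasurableSet A →
    Measurable fun x => P x (X t ⁻¹' A)
  markov : ∀ (x : S) (s t : ℝ≥0) (A : Set S), MeasurableSet A →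
    (P x)[(X (s + t) ⁻¹' A).indicator (fun _ => (1 : ℝ)) | ℱ s]
      =ᵐ[P x] fun ω => (P (X s ω)).real (X t ⁻¹' A)

/-- Stochastic continuity: the transition probabilities `P_x(X_t ∈ ·)` are weakly continuous
in `t`. -/
def IsStochasticallyContinuous {S Ω : Type*} [TopologicalSpace S] [MeasurableSpace Ω]
    (X : ℝ≥0 → Ω → S) (P : S → Measure Ω) : Prop :=
  ∀ (x : S) (f : BoundedContinuousFunction S ℝ), Continuous fun t => ∫ ω, f (X t ω) ∂(P x)

/-- `(X, P_x)` is an affine process on `S_d^+` with characteristic exponents `φ, ψ`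
(whose values at negative times are irrelevant). -/
structure IsAffineProcess {d : ℕ} {Ω : Type*} [mΩ : MeasurableSpace Ω]
    (ℱ : Filtration ℝ≥0 mΩ) (X : ℝ≥0 → Ω → PSDCone d) (P : PSDCone d → Measure Ω)
    (φ : ℝ → PSDCone d → ℝ) (ψ : ℝ → PSDCone d → PSDCone d) : Prop where
  markov : IsMarkovProcess ℱ X P
  stochasticallyContinuous : IsStochasticallyContinuous X P
  affine : ∀ (t : ℝ≥0) (x u : PSDCone d),
    ∫ ω, Real.exp (-(u.pairing (X t ω))) ∂(P x) = Real.exp (-φ t u - (ψ t u).pairing x)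

/-- `(X, P_x)` is a Wishart process on `S_d^+` with parameters `(p, α, β)`: an affine process whose
characteristic exponents solve the Riccati equations
`φ' = 2 p ⟨α, ψ⟩`, `φ(0, u) = 0`, `ψ' = -2 ψ α ψ + ψ β + βᵀ ψ`, `ψ(0, u) = u` on `[0, ∞)`
(the second one is written out entry by entry). -/
def IsWishartProcess {d : ℕ} {Ω : Type*} [mΩ : MeasurableSpace Ω]
    (ℱ : Filtration ℝ≥0 mΩ) (X : ℝ≥0 → Ω → PSDCone d) (P : PSDCone d → Measure Ω)
    (p : ℝ) (α : PSDCone d) (β : Matrix (Fin d) (Fin d) ℝ) : Prop :=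
  0 ≤ p ∧ ∃ (φ : ℝ → PSDCone d → ℝ) (ψ : ℝ → PSDCone d → PSDCone d),
    IsAffineProcess ℱ X P φ ψ ∧
    (∀ u, φ 0 u = 0) ∧
    (∀ u, ψ 0 u = u) ∧
    (∀ u, ∀ t ≥ (0 : ℝ),
      HasDerivWithinAt (fun s => φ s u) (2 * p * α.pairing (ψ t u)) (Set.Ici 0) t) ∧
    (∀ u, ∀ t ≥ (0 : ℝ), ∀ i j,
      HasDerivWithinAt (fun s => (ψ s u).1 i j)
        ((-(2 : ℝ) • ((ψ t u).1 * α.1 * (ψ t u).1) + (ψ t u).1 * β + βᵀ * (ψ t u).1) i j)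
        (Set.Ici 0) t)

/-- The flow `ω_t^β(x) = e^{β t} x e^{βᵀ t}` of the vector field `β x + x βᵀ` on `S_d^+`. -/
noncomputable def wishartFlow {d : ℕ} (β : Matrix (Fin d) (Fin d) ℝ) (t : ℝ) (x : PSDCone d) :
    PSDCone d :=
  ⟨NormedSpace.exp (t • β) * x.1 * NormedSpace.exp (t • βᵀ), by
    have h := x.2.mul_mul_conjTranspose_same (NormedSpace.exp (t • β))
    rwa [← Matrix.exp_conjTranspose, Matrix.conjTranspose_smul, star_trivial,
      Matrix.conjTranspose_eq_transpose_of_trivial] at h⟩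

/-- The entries of the flow are continuous in time. -/
theorem continuous_wishartFlow_entry {d : ℕ} (β : Matrix (Fin d) (Fin d) ℝ) (x : PSDCone d)
    (i j : Fin d) : Continuous fun s : ℝ => (wishartFlow β s x).1 i j := by
  let _ : NormedRing (Matrix (Fin d) (Fin d) ℝ) := Matrix.linftyOpNormedRing
  let _ : NormedAlgebra ℝ (Matrix (Fin d) (Fin d) ℝ) := Matrix.linftyOpNormedAlgebra
  let _ : NormedAlgebra ℚ (Matrix (Fin d) (Fin d) ℝ) := NormedAlgebra.restrictScalars ℚ ℝ _
  have h : ∀ b : Matrix (Fin d) (Fin d) ℝ, Continuous fun s : ℝ => NormedSpace.exp (s • b) :=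
    fun b => NormedSpace.exp_continuous.comp (continuous_id.smul continuous_const)
  have h2 : Continuous fun s : ℝ =>
      NormedSpace.exp (s • β) * x.1 * NormedSpace.exp (s • βᵀ) :=
    ((h β).mul continuous_const).mul (h βᵀ)
  exact h2.matrix_elem i j

/-- The integrated flow `σ_t^β(x) = 2 ∫_0^t ω_s^β(x) ds` (entrywise integral), for `t ≥ 0`. -/
noncomputable def wishartScale {d : ℕ} (β : Matrix (Fin d) (Fin d) ℝ) (t : ℝ≥0) (x : PSDCone d) :
    PSDCone d :=
  ⟨Matrix.of fun i j => 2 * ∫ s in (0 : ℝ)..t, (wishartFlow β s x).1 i j, by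
    refine Matrix.PosSemidef.of_dotProduct_mulVec_nonneg ?_ ?_
    · ext i j
      simp only [Matrix.conjTranspose_apply, Matrix.of_apply, star_trivial]
      congr 2
      ext s
      simpa using (wishartFlow β s x).2.1.apply i j
    · intro v
      have key : star v ⬝ᵥ (Matrix.of fun i j =>
            2 * ∫ s in (0 : ℝ)..t, (wishartFlow β s x).1 i j) *ᵥ v
          = 2 * ∫ s in (0 : ℝ)..t, star v ⬝ᵥ (wishartFlow β s x).1 *ᵥ v := by
        simp only [dotProduct, Matrix.mulVec, Matrix.of_apply]
        rw [intervalIntegral.integral_finsetSum]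
        · rw [Finset.mul_sum]
          refine Finset.sum_congr rfl fun i _ => ?_
          rw [intervalIntegral.integral_const_mul, intervalIntegral.integral_finsetSum]
          · rw [mul_left_comm, Finset.mul_sum _ _ (2 : ℝ)]
            congr 1
            refine Finset.sum_congr rfl fun j _ => ?_
            rw [intervalIntegral.integral_mul_const, mul_assoc]
          · intro j _
            exact ((continuous_wishartFlow_entry β x i j).mul
              continuous_const).intervalIntegrable _ _
        · intro i _
          refine Continuous.intervalIntegrable ?_ _ _
          exact continuous_const.mul (continuous_finsetSum _ fun j _ =>
            (continuous_wishartFlow_entry β x i j).mul continuous_const)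
      rw [key]
      refine mul_nonneg zero_le_two (intervalIntegral.integral_nonneg t.2 fun s _ => ?_)
      exact (wishartFlow β s x).2.dotProduct_mulVec_nonneg v⟩

/-
The Riccati equation linearizes: its solution is `ψ(t, u) = e^{βᵀ t} u (1 + σ_t u)⁻¹ e^{β t}` with
`σ_t = σ_t^β(α)`, and `φ(t, u) = p log det (1 + σ_t u)`, so that `X_t` has the Laplace transform of
`Γ(p, ω_t^β(x); σ_t)`. It determines the law, because the functions `e^{-⟨u, ·⟩}` form a
multiplicative system that separates the points of the cone. For the density it thus suffices to
construct, for `p > (d - 1) / 2` and positive definite `σ`, some absolutely continuous measure with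
the Laplace transform of `Γ(p, ω; σ)`. Simultaneous diagonalization reduces this to `σ = 1` and
diagonal `ω`; then one inducts on the dimension, adding `1 / 2` to `p` at each step: if `S` has law
`Γ(p - 1/2, ω; 1)` and `w` is an independent centred Gaussian vector, border `S + w wᵀ` by a
conditionally Gaussian column so that the Schur complement has a non-central gamma law.
-/

section PosSemidef

variable {n : Type*} [Fintype n]

section RCLike

open scoped ComplexOrder

variable {𝕜 : Type*} [RCLike 𝕜] {a b : Matrix n n 𝕜}

open scoped MatrixOrder Matrix.Norms.L2Operator in
theorem exists_eq_conjTranspose_mul_self_of_posSemidef (ha : a.PosSemidef) :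
    ∃ g : Matrix n n 𝕜, a = gᴴ * g := by
  classical
  exact CStarAlgebra.nonneg_iff_eq_star_mul_self.mp ha.nonneg

theorem trace_mul_nonneg_of_posSemidef (ha : a.PosSemidef) (hb : b.PosSemidef) :
    0 ≤ (a * b).trace := by
  obtain ⟨g, rfl⟩ := exists_eq_conjTranspose_mul_self_of_posSemidef ha
  rw [Matrix.mul_assoc, Matrix.trace_mul_comm]
  exact (hb.mul_mul_conjTranspose_same g).trace_nonneg

theorem det_one_add_mul_pos_of_posSemidef [DecidableEq n] (ha : a.PosSemidef)
    (hb : b.PosSemidef) : 0 < (1 + a * b).det := by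
  obtain ⟨g, rfl⟩ := exists_eq_conjTranspose_mul_self_of_posSemidef ha
  rw [Matrix.mul_assoc, Matrix.det_one_add_mul_comm]
  exact (Matrix.PosDef.one.add_posSemidef (hb.mul_mul_conjTranspose_same g)).det_pos

end RCLike

theorem posSemidef_vecMulVec_self {n : Type*} [Finite n] (v : n → ℝ) :
    (Matrix.vecMulVec v v).PosSemidef := by
  simpa using Matrix.posSemidef_vecMulVec_self_star v

theorem isClosed_setOf_posSemidef {n : Type*} [Finite n] :
    IsClosed {x : Matrix n n ℝ | x.PosSemidef} := by
  cases nonempty_fintype n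
  have heq : {x : Matrix n n ℝ | x.PosSemidef} =
      {x | xᴴ = x} ∩ ⋂ v : n → ℝ, {x | 0 ≤ star v ⬝ᵥ (x *ᵥ v)} := by
    ext x
    simp only [Set.mem_ofPred_eq, Set.mem_inter_iff, Set.mem_iInter]
    exact ⟨fun h => ⟨h.1.eq, fun v => h.dotProduct_mulVec_nonneg v⟩,
      fun h => Matrix.PosSemidef.of_dotProduct_mulVec_nonneg h.1 h.2⟩
  rw [heq]
  exact (isClosed_eq continuous_id.matrix_conjTranspose continuous_id).inter
    (isClosed_iInter fun v => isClosed_le continuous_const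
      (continuous_const.dotProduct (continuous_id.matrix_mulVec continuous_const)))

theorem exists_orthogonal_diagonalization [DecidableEq n] {b : Matrix n n ℝ} (hb : b.PosSemidef) :
    ∃ U : Matrix n n ℝ, ∃ l : n → ℝ,
      U * Uᵀ = 1 ∧ (∀ i, 0 ≤ l i) ∧ b = U * Matrix.diagonal l * Uᵀ :=
  ⟨hb.1.eigenvectorUnitary, hb.1.eigenvalues, by
    simpa [Matrix.star_eq_conjTranspose] using Unitary.coe_mul_star_self hb.1.eigenvectorUnitary,
    hb.eigenvalues_nonneg, by
    simpa [Unitary.conjStarAlgAut_apply, Matrix.star_eq_conjTranspose] using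
      hb.1.spectral_theorem⟩

theorem exists_simultaneous_diagonalization [DecidableEq n] {a b : Matrix n n ℝ} (ha : a.PosDef)
    (hb : b.PosSemidef) :
    ∃ g h : Matrix n n ℝ, ∃ l : n → ℝ, g * h = 1 ∧ (∀ i, 0 ≤ l i) ∧ a = g * gᵀ ∧
      b = g * Matrix.diagonal l * gᵀ := by
  obtain ⟨r, hr⟩ := exists_eq_conjTranspose_mul_self_of_posSemidef ha.posSemidef
  rw [Matrix.conjTranspose_eq_transpose_of_trivial] at hr
  have hr_unit : IsUnit r.det := by
    have hdet := ha.det_pos.ne'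
    rw [hr, Matrix.det_mul] at hdet
    exact (right_ne_zero_of_mul hdet).isUnit
  have hrr : r⁻¹ * r = 1 := Matrix.nonsing_inv_mul _ hr_unit
  have hrT : rᵀ * r⁻¹ᵀ = 1 := by rw [← Matrix.transpose_mul, hrr, Matrix.transpose_one]
  have hc : (r⁻¹ᵀ * b * r⁻¹).PosSemidef := by
    simpa using hb.conjTranspose_mul_mul_same r⁻¹
  obtain ⟨U, l, hUU, hl, hUl⟩ := exists_orthogonal_diagonalization hc
  refine ⟨rᵀ * U, Uᵀ * r⁻¹ᵀ, l, ?_, hl, ?_, ?_⟩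
  · calc rᵀ * U * (Uᵀ * r⁻¹ᵀ) = rᵀ * (U * Uᵀ) * r⁻¹ᵀ := by simp only [Matrix.mul_assoc]
      _ = 1 := by rw [hUU, Matrix.mul_one, hrT]
  · calc a = rᵀ * (U * Uᵀ) * r := by rw [hUU, Matrix.mul_one, hr]
      _ = rᵀ * U * (rᵀ * U)ᵀ := by
        simp only [Matrix.transpose_mul, Matrix.transpose_transpose, Matrix.mul_assoc]
  · calc b = rᵀ * r⁻¹ᵀ * b * (r⁻¹ * r) := by rw [hrT, hrr, Matrix.one_mul, Matrix.mul_one]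
      _ = rᵀ * (r⁻¹ᵀ * b * r⁻¹) * r := by simp only [Matrix.mul_assoc]
      _ = rᵀ * U * Matrix.diagonal l * (rᵀ * U)ᵀ := by
        rw [hUl, Matrix.transpose_mul, Matrix.transpose_transpose]
        simp only [Matrix.mul_assoc]

end PosSemidef

theorem ext_of_forall_mem_submonoid_integral_eq {E : Type*} [TopologicalSpace E] [PolishSpace E]
    [MeasurableSpace E] [BorelSpace E] {μ ν : Measure E} [IsFiniteMeasure μ] [IsFiniteMeasure ν]
    (S : Submonoid (BoundedContinuousFunction E ℝ))
    (hsep : ∀ x y, x ≠ y → ∃ f ∈ S, f x ≠ f y)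
    (h : ∀ f ∈ S, ∫ x, f x ∂μ = ∫ x, f x ∂ν) : μ = ν := by
  let A : StarSubalgebra ℝ (BoundedContinuousFunction E ℝ) :=
    { Algebra.adjoin ℝ (S : Set (BoundedContinuousFunction E ℝ)) with
      star_mem' := fun {f} hf => by
        have : star f = f := by ext x; simp
        rwa [this] }
  refine ext_of_forall_mem_subalgebra_integral_eq_of_polish (𝕜 := ℝ) (A := A) ?_ ?_
  · intro x y hxy
    obtain ⟨f, hf, hne⟩ := hsep x y hxy
    exact ⟨_, ⟨_, ⟨f, Algebra.subset_adjoin hf, rfl⟩, rfl⟩, hne⟩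
  · intro g hg
    replace hg : g ∈ Submodule.span ℝ (S : Set (BoundedContinuousFunction E ℝ)) := by
      have hg' : g ∈ Subalgebra.toSubmodule
          (Algebra.adjoin ℝ (S : Set (BoundedContinuousFunction E ℝ))) := hg
      rwa [Algebra.adjoin_eq_span, Submonoid.closure_eq] at hg'
    induction hg using Submodule.span_induction with
    | mem f hf => exact h f hf
    | zero => simp
    | add f g _ _ hf hg =>
      simp only [BoundedContinuousFunction.coe_add, Pi.add_apply]
      rw [integral_add (f.integrable μ) (g.integrable μ),
        integral_add (f.integrable ν) (g.integrable ν), hf, hg]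
    | smul c f _ hf =>
      simp only [BoundedContinuousFunction.coe_smul]
      rw [integral_smul, integral_smul, hf]

namespace PSDCone

variable {d : ℕ}

instance polishSpace : PolishSpace (PSDCone d) := by
  have : PolishSpace (Matrix (Fin d) (Fin d) ℝ) :=
    inferInstanceAs (PolishSpace (Fin d → Fin d → ℝ))
  exact isClosed_setOf_posSemidef.polishSpace

theorem continuous_pairing (u : PSDCone d) : Continuous fun x => u.pairing x :=
  (continuous_const.matrix_mul continuous_subtype_val).matrix_trace

theorem pairing_nonneg (u x : PSDCone d) : 0 ≤ u.pairing x :=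
  trace_mul_nonneg_of_posSemidef u.2 x.2

theorem eq_of_pairing_eq {x y : PSDCone d} (h : ∀ u : PSDCone d, u.pairing x = u.pairing y) :
    x = y := by
  have hx := h x
  have hy := h y
  simp only [pairing] at hx hy
  have htrace : ((x.1 - y.1)ᴴ * (x.1 - y.1)).trace = 0 := by
    rw [Matrix.conjTranspose_sub, x.2.1.eq, y.2.1.eq, Matrix.sub_mul, Matrix.mul_sub,
      Matrix.mul_sub, Matrix.trace_sub, Matrix.trace_sub, Matrix.trace_sub]
    linarith
  exact Subtype.ext (sub_eq_zero.1 (Matrix.trace_conjTranspose_mul_self_eq_zero_iff.1 htrace))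

/-- The function `x ↦ exp (-⟨u, x⟩)` as a bounded continuous function on the cone; these are the
test functions of the Laplace transform. -/
noncomputable def expNegPairing (u : PSDCone d) : BoundedContinuousFunction (PSDCone d) ℝ :=
  BoundedContinuousFunction.ofNormedAddCommGroup (fun x => Real.exp (-(u.pairing x)))
    (Real.continuous_exp.comp (continuous_pairing u).neg) 1 fun x => by
      rw [Real.norm_eq_abs, Real.abs_exp, Real.exp_le_one_iff]
      exact neg_nonpos.2 (pairing_nonneg u x)

theorem expNegPairing_mul (u v : PSDCone d) :
    expNegPairing u * expNegPairing v = expNegPairing ⟨u.1 + v.1, u.2.add v.2⟩ := by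
  ext x
  change Real.exp (-(u.1 * x.1).trace) * Real.exp (-(v.1 * x.1).trace) =
    Real.exp (-((u.1 + v.1) * x.1).trace)
  rw [← Real.exp_add, Matrix.add_mul, Matrix.trace_add, neg_add]

theorem expNegPairing_zero :
    expNegPairing (⟨0, Matrix.PosSemidef.zero⟩ : PSDCone d) = 1 := by
  ext x
  change Real.exp (-((0 : Matrix (Fin d) (Fin d) ℝ) * x.1).trace) = 1
  rw [Matrix.zero_mul, Matrix.trace_zero, neg_zero, Real.exp_zero]

theorem measure_ext_of_laplace {μ ν : Measure (PSDCone d)} [IsFiniteMeasure μ] [IsFiniteMeasure ν]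
    (h : ∀ u : PSDCone d, ∫ ξ, Real.exp (-(u.pairing ξ)) ∂μ = ∫ ξ, Real.exp (-(u.pairing ξ)) ∂ν) :
    μ = ν := by
  let S : Submonoid (BoundedContinuousFunction (PSDCone d) ℝ) :=
    { carrier := Set.range expNegPairing
      mul_mem' := by
        rintro _ _ ⟨u, rfl⟩ ⟨v, rfl⟩
        exact ⟨_, (expNegPairing_mul u v).symm⟩
      one_mem' := ⟨_, expNegPairing_zero⟩ }
  refine ext_of_forall_mem_submonoid_integral_eq S (fun x y hxy => ?_) ?_
  · by_contra! hcon
    exact hxy (eq_of_pairing_eq fun u =>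
      neg_injective (Real.exp_injective (hcon (expNegPairing u) ⟨u, rfl⟩)))
  · rintro _ ⟨u, rfl⟩
    exact h u

end PSDCone

namespace IsNoncentralWishart

variable {d : ℕ} {p : ℝ} {ω σ : PSDCone d} {μ ν : Measure (PSDCone d)}

theorem unique (hμ : IsNoncentralWishart p ω σ μ) (hν : IsNoncentralWishart p ω σ ν) : μ = ν := by
  have := hμ.isProbabilityMeasure
  have := hν.isProbabilityMeasure
  exact PSDCone.measure_ext_of_laplace fun u => by rw [hμ.laplace, hν.laplace]

theorem eq_noncentralWishart (hμ : IsNoncentralWishart p ω σ μ) :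
    μ = noncentralWishart p ω σ := by
  have h : ∃ μ, IsNoncentralWishart p ω σ μ := ⟨μ, hμ⟩
  rw [noncentralWishart, dif_pos h]
  exact hμ.unique h.choose_spec

end IsNoncentralWishart

section BanachAlgebra

variable {𝔸 : Type*} [NormedRing 𝔸] [NormedAlgebra ℝ 𝔸]

theorem eq_zero_of_hasDerivWithinAt_mul {B M : ℝ → 𝔸} (hM : ContinuousOn M (Set.Ici 0))
    (h0 : B 0 = 0) (hB : ∀ t ≥ (0 : ℝ), HasDerivWithinAt B (M t * B t) (Set.Ici 0) t) {t : ℝ}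
    (ht : 0 ≤ t) : B t = 0 := by
  obtain ⟨C, hC⟩ := isCompact_Icc.exists_bound_of_continuousOn
    (hM.mono (Set.Icc_subset_Ici_self : Set.Icc 0 t ⊆ Set.Ici 0))
  have hlip : ∀ s ∈ Set.Ico 0 t, LipschitzOnWith C.toNNReal (fun x : 𝔸 => M s * x) Set.univ := by
    intro s hs
    refine LipschitzOnWith.of_dist_le_mul fun x _ y _ => ?_
    rw [dist_eq_norm, dist_eq_norm, ← mul_sub]
    refine (norm_mul_le _ _).trans (mul_le_mul_of_nonneg_right ?_ (norm_nonneg _))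
    exact (hC s (Set.Ico_subset_Icc_self hs)).trans (Real.le_coe_toNNReal C)
  have hunique := ODE_solution_unique_of_mem_Icc_right (f := B) (g := fun _ => 0) (a := 0) (b := t)
    (s := fun _ => Set.univ) (v := fun s x => M s * x) hlip
    (fun s hs => (hB s hs.1).continuousWithinAt.mono Set.Icc_subset_Ici_self)
    (fun s hs => (hB s hs.1).mono (Set.Ici_subset_Ici.2 hs.1)) (fun _ _ => trivial)
    continuousOn_const
    (fun s _ => by simpa using hasDerivWithinAt_const s (Set.Ici s) (0 : 𝔸))
    (fun _ _ => trivial) h0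
  exact hunique ⟨ht, le_rfl⟩

-- `A (1 + S u) - u` solves the linear equation `B' = -(A S') B`.
theorem mul_one_add_mul_eq_of_hasDerivWithinAt {A S S' : ℝ → 𝔸} {u : 𝔸} (hA0 : A 0 = u)
    (hS0 : S 0 = 0) (hS' : ContinuousOn S' (Set.Ici 0))
    (hA : ∀ t ≥ (0 : ℝ), HasDerivWithinAt A (-(A t * S' t * A t)) (Set.Ici 0) t)
    (hS : ∀ t ≥ (0 : ℝ), HasDerivWithinAt S (S' t) (Set.Ici 0) t) {t : ℝ} (ht : 0 ≤ t) :
    A t * (1 + S t * u) = u := by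
  have hB : ∀ s ≥ (0 : ℝ), HasDerivWithinAt (fun r => A r * (1 + S r * u) - u)
      (-(A s * S' s) * (A s * (1 + S s * u) - u)) (Set.Ici 0) s := fun s hs => by
    refine (((hA s hs).mul (((hS s hs).mul_const u).const_add 1)).sub_const u).congr_deriv ?_
    noncomm_ring
  have hA_cont : ContinuousOn A (Set.Ici 0) := fun s hs => (hA s hs).continuousWithinAt
  exact sub_eq_zero.1
    (eq_zero_of_hasDerivWithinAt_mul (hA_cont.mul hS').neg (by simp [hA0, hS0]) hB ht)

variable [CompleteSpace 𝔸]

theorem exp_smul_neg_mul_exp_smul (b : 𝔸) (t : ℝ) :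
    NormedSpace.exp (t • -b) * NormedSpace.exp (t • b) = 1 := by
  let _ : NormedAlgebra ℚ 𝔸 := NormedAlgebra.restrictScalars ℚ ℝ 𝔸
  rw [smul_neg, ← NormedSpace.exp_add_of_commute (Commute.refl (t • b)).neg_left, neg_add_cancel,
    NormedSpace.exp_zero]

theorem exp_smul_mul_exp_smul_neg (b : 𝔸) (t : ℝ) :
    NormedSpace.exp (t • b) * NormedSpace.exp (t • -b) = 1 := by
  simpa only [neg_neg] using exp_smul_neg_mul_exp_smul (-b) t

theorem exp_mul_exp_neg_mul_exp_neg_mul_exp (β γ x : 𝔸) (t : ℝ) :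
    NormedSpace.exp (t • γ) * (NormedSpace.exp (t • -γ) * x * NormedSpace.exp (t • -β)) *
      NormedSpace.exp (t • β) = x := by
  calc _ = (NormedSpace.exp (t • γ) * NormedSpace.exp (t • -γ)) * x *
        (NormedSpace.exp (t • -β) * NormedSpace.exp (t • β)) := by simp only [mul_assoc]
    _ = x := by rw [exp_smul_mul_exp_smul_neg, exp_smul_neg_mul_exp_smul, one_mul, mul_one]

theorem hasDerivWithinAt_exp_mul_mul_exp {ψ : ℝ → 𝔸} {α β γ : 𝔸} {s : Set ℝ} {t : ℝ}
    (hψ : HasDerivWithinAt ψ (-(2 : ℝ) • (ψ t * α * ψ t) + ψ t * β + γ * ψ t) s t) :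
    HasDerivWithinAt (fun r => NormedSpace.exp (r • -γ) * ψ r * NormedSpace.exp (r • -β))
      (-(NormedSpace.exp (t • -γ) * ψ t * NormedSpace.exp (t • -β) *
        ((2 : ℝ) • (NormedSpace.exp (t • β) * α * NormedSpace.exp (t • γ))) *
        (NormedSpace.exp (t • -γ) * ψ t * NormedSpace.exp (t • -β)))) s t := by
  have hγ := (hasDerivAt_exp_smul_const (-γ) t).hasDerivWithinAt (s := s)
  have hβ := (hasDerivAt_exp_smul_const' (-β) t).hasDerivWithinAt (s := s)
  refine ((hγ.mul hψ).mul hβ).congr_deriv ?_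
  have hcancel : NormedSpace.exp (t • -γ) * ψ t * NormedSpace.exp (t • -β) *
      ((2 : ℝ) • (NormedSpace.exp (t • β) * α * NormedSpace.exp (t • γ))) *
      (NormedSpace.exp (t • -γ) * ψ t * NormedSpace.exp (t • -β)) =
      (2 : ℝ) • (NormedSpace.exp (t • -γ) * (ψ t * α * ψ t) * NormedSpace.exp (t • -β)) := by
    rw [mul_smul_comm, smul_mul_assoc]
    congr 1
    calc _ = NormedSpace.exp (t • -γ) * ψ t *
          (NormedSpace.exp (t • -β) * NormedSpace.exp (t • β)) * α *
          (NormedSpace.exp (t • γ) * NormedSpace.exp (t • -γ)) * ψ t *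
          NormedSpace.exp (t • -β) := by simp only [mul_assoc]
      _ = _ := by
        rw [exp_smul_neg_mul_exp_smul, exp_smul_mul_exp_smul_neg]
        simp only [mul_assoc, one_mul]
  rw [hcancel]
  simp only [Pi.mul_apply, neg_smul, mul_add, add_mul, mul_neg, neg_mul, mul_smul_comm,
    smul_mul_assoc, mul_assoc]
  abel

theorem riccati_exp_mul_mul_exp_mul_eq {ψ S : ℝ → 𝔸} {α β γ u : 𝔸} (hψ0 : ψ 0 = u)
    (hψ : ∀ t ≥ (0 : ℝ),
      HasDerivWithinAt ψ (-(2 : ℝ) • (ψ t * α * ψ t) + ψ t * β + γ * ψ t) (Set.Ici 0) t)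
    (hS0 : S 0 = 0)
    (hS : ∀ t ≥ (0 : ℝ), HasDerivWithinAt S
      ((2 : ℝ) • (NormedSpace.exp (t • β) * α * NormedSpace.exp (t • γ))) (Set.Ici 0) t)
    {t : ℝ} (ht : 0 ≤ t) :
    NormedSpace.exp (t • -γ) * ψ t * NormedSpace.exp (t • -β) * (1 + S t * u) = u := by
  let _ : NormedAlgebra ℚ 𝔸 := NormedAlgebra.restrictScalars ℚ ℝ 𝔸
  have hexp (b : 𝔸) : Continuous fun r : ℝ => NormedSpace.exp (r • b) :=
    NormedSpace.exp_continuous.comp (continuous_id.smul continuous_const)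
  exact mul_one_add_mul_eq_of_hasDerivWithinAt
    (A := fun r => NormedSpace.exp (r • -γ) * ψ r * NormedSpace.exp (r • -β))
    (by simp [hψ0]) hS0
    ((((hexp β).mul continuous_const).mul (hexp γ)).const_smul (2 : ℝ)).continuousOn
    (fun s hs => hasDerivWithinAt_exp_mul_mul_exp (hψ s hs)) hS ht

end BanachAlgebra

section Riccati

attribute [local instance] Matrix.linftyOpNormedRing Matrix.linftyOpNormedAlgebra

theorem hasDerivWithinAt_det {n : Type*} [Fintype n] [DecidableEq n] {f : ℝ → Matrix n n ℝ}
    {f' : Matrix n n ℝ} {s : Set ℝ} {t : ℝ} (hf : HasDerivWithinAt f f' s t) :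
    HasDerivWithinAt (fun r => (f r).det) (((f t).adjugate * f').trace) s t := by
  let D : ContinuousMultilinearMap ℝ (fun _ : n => n → ℝ) ℝ :=
    { (Matrix.detRowAlternating (n := n) (R := ℝ)).toMultilinearMap with
      cont := Continuous.matrix_det continuous_id }
  refine ((D.hasFDerivAt (f t)).comp_hasDerivWithinAt t hf).congr_deriv ?_
  refine (ContinuousMultilinearMap.linearDeriv_apply D (f t) f').trans ?_
  rw [Matrix.trace_mul_comm, Matrix.trace]
  refine Finset.sum_congr rfl fun i _ => ?_
  change ((f t).updateRow i (f' i)).det = _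
  rw [Matrix.diag_apply, ← Matrix.cramer_transpose_apply, Matrix.cramer_eq_adjugate_mulVec,
    ← Matrix.adjugate_transpose, Matrix.mulVec_transpose]
  rfl

theorem hasDerivWithinAt_log_det {n : Type*} [Fintype n] [DecidableEq n] {f : ℝ → Matrix n n ℝ}
    {f' : Matrix n n ℝ} {s : Set ℝ} {t : ℝ} (hf : HasDerivWithinAt f f' s t)
    (hdet : (f t).det ≠ 0) :
    HasDerivWithinAt (fun r => Real.log (f r).det) (((f t)⁻¹ * f').trace) s t := by
  refine ((hasDerivWithinAt_det hf).log hdet).congr_deriv ?_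
  rw [Matrix.inv_def, Ring.inverse_eq_inv', Matrix.smul_mul, Matrix.trace_smul, smul_eq_mul,
    div_eq_inv_mul]

variable {d : ℕ}

/-- `σ_t^β(x)` as a function of real time `t`, which makes it possible to differentiate it. -/
noncomputable def integratedFlow (β : Matrix (Fin d) (Fin d) ℝ) (x : PSDCone d) (t : ℝ) :
    Matrix (Fin d) (Fin d) ℝ :=
  Matrix.of fun i j => 2 * ∫ s in (0 : ℝ)..t, (wishartFlow β s x).1 i j

variable (α : PSDCone d) (β : Matrix (Fin d) (Fin d) ℝ)

theorem integratedFlow_zero : integratedFlow β α 0 = 0 := by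
  ext i j
  simp [integratedFlow]

theorem integratedFlow_posSemidef {t : ℝ} (ht : 0 ≤ t) : (integratedFlow β α t).PosSemidef :=
  (wishartScale β ⟨t, ht⟩ α).2

theorem hasDerivAt_integratedFlow (t : ℝ) :
    HasDerivAt (integratedFlow β α) ((2 : ℝ) • (wishartFlow β t α).1) t := by
  refine hasDerivAt_pi.2 fun i => hasDerivAt_pi.2 fun j => ?_
  have hc := continuous_wishartFlow_entry β α i j
  exact (intervalIntegral.integral_hasDerivAt_right (hc.intervalIntegrable _ _)
    (hc.stronglyMeasurableAtFilter _ _) hc.continuousAt).const_mul 2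

variable {α β} {u : Matrix (Fin d) (Fin d) ℝ} {ψ : ℝ → Matrix (Fin d) (Fin d) ℝ}

theorem riccati_solution (hu : u.PosSemidef) (hψ0 : ψ 0 = u)
    (hψ : ∀ t ≥ (0 : ℝ), HasDerivWithinAt ψ
      (-(2 : ℝ) • (ψ t * α.1 * ψ t) + ψ t * β + βᵀ * ψ t) (Set.Ici 0) t)
    {t : ℝ} (ht : 0 ≤ t) :
    ψ t = NormedSpace.exp (t • βᵀ) * (u * (1 + integratedFlow β α t * u)⁻¹) *
      NormedSpace.exp (t • β) := by
  have hunit : IsUnit (1 + integratedFlow β α t * u).det :=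
    (det_one_add_mul_pos_of_posSemidef (integratedFlow_posSemidef α β ht) hu).ne'.isUnit
  have hconj := exp_mul_exp_neg_mul_exp_neg_mul_exp β βᵀ (ψ t) t
  have hA := riccati_exp_mul_mul_exp_mul_eq hψ0 hψ (integratedFlow_zero α β)
    (fun s _ => (hasDerivAt_integratedFlow α β s).hasDerivWithinAt) ht
  have hquot : NormedSpace.exp (t • -βᵀ) * ψ t * NormedSpace.exp (t • -β) =
      u * (1 + integratedFlow β α t * u)⁻¹ :=
    (Matrix.mul_nonsing_inv_cancel_right _ _ hunit).symm.trans
      (congrArg (· * (1 + integratedFlow β α t * u)⁻¹) hA)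
  exact hconj.symm.trans
    (congrArg (fun y => NormedSpace.exp (t • βᵀ) * y * NormedSpace.exp (t • β)) hquot)

theorem riccati_integral {p : ℝ} {φ : ℝ → ℝ} (hu : u.PosSemidef) (hψ0 : ψ 0 = u)
    (hψ : ∀ t ≥ (0 : ℝ), HasDerivWithinAt ψ
      (-(2 : ℝ) • (ψ t * α.1 * ψ t) + ψ t * β + βᵀ * ψ t) (Set.Ici 0) t)
    (hφ0 : φ 0 = 0)
    (hφ : ∀ t ≥ (0 : ℝ), HasDerivWithinAt φ (2 * p * (α.1 * ψ t).trace) (Set.Ici 0) t)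
    {t : ℝ} (ht : 0 ≤ t) :
    φ t = p * Real.log (1 + integratedFlow β α t * u).det := by
  have hlog : ∀ s ≥ (0 : ℝ), HasDerivWithinAt
      (fun r => p * Real.log (1 + integratedFlow β α r * u).det)
      (2 * p * (α.1 * ψ s).trace) (Set.Ici 0) s := by
    intro s hs
    have hdet := det_one_add_mul_pos_of_posSemidef (integratedFlow_posSemidef α β hs) hu
    have hS := (hasDerivAt_integratedFlow α β s).hasDerivWithinAt (s := Set.Ici 0)
    refine ((hasDerivWithinAt_log_det ((hS.mul_const u).const_add 1) hdet.ne').const_mul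
      p).congr_deriv ?_
    have htrace : (α.1 * ψ s).trace =
        ((1 + integratedFlow β α s * u)⁻¹ * ((wishartFlow β s α).1 * u)).trace := by
      rw [riccati_solution hu hψ0 hψ hs, wishartFlow, Matrix.trace_mul_comm _ (_ * u),
        ← Matrix.mul_assoc α.1, Matrix.trace_mul_comm _ (NormedSpace.exp (s • β))]
      simp only [Matrix.mul_assoc]
    rw [htrace, Matrix.smul_mul, Matrix.mul_smul, Matrix.trace_smul, smul_eq_mul]
    ring
  refine eq_of_has_deriv_right_eq (a := 0) (b := t)
    (fun s hs => (hφ s hs.1).mono (Set.Ici_subset_Ici.2 hs.1))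
    (fun s hs => (hlog s hs.1).mono (Set.Ici_subset_Ici.2 hs.1))
    (fun s hs => (hφ s hs.1).continuousWithinAt.mono Set.Icc_subset_Ici_self)
    (fun s hs => (hlog s hs.1).continuousWithinAt.mono Set.Icc_subset_Ici_self) ?_ t ⟨ht, le_rfl⟩
  simp [hφ0, integratedFlow_zero]

end Riccati

theorem IsWishartProcess.isNoncentralWishart {d : ℕ} {Ω : Type*} [mΩ : MeasurableSpace Ω]
    {ℱ : Filtration ℝ≥0 mΩ} {X : ℝ≥0 → Ω → PSDCone d} {P : PSDCone d → Measure Ω}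
    {p : ℝ} {α : PSDCone d} {β : Matrix (Fin d) (Fin d) ℝ}
    (hX : IsWishartProcess ℱ X P p α β) (t : ℝ≥0) (x : PSDCone d) :
    IsNoncentralWishart p (wishartFlow β t x) (wishartScale β t α) ((P x).map (X t)) := by
  obtain ⟨-, φ, ψ, haff, hφ0, hψ0, hφ, hψ⟩ := hX
  have hmeas : AEMeasurable (X t) (P x) :=
    ((haff.markov.adapted t).mono (ℱ.le t) le_rfl).aemeasurable
  have := haff.markov.isProbabilityMeasure x
  refine ⟨Measure.isProbabilityMeasure_map hmeas, fun u => ?_⟩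
  have hψ' : ∀ s ≥ (0 : ℝ), HasDerivWithinAt (fun r => (ψ r u).1)
      (-(2 : ℝ) • ((ψ s u).1 * α.1 * (ψ s u).1) + (ψ s u).1 * β + βᵀ * (ψ s u).1)
      (Set.Ici 0) s := fun s hs =>
    hasDerivWithinAt_pi.2 fun i => hasDerivWithinAt_pi.2 fun j => hψ u s hs i j
  have hψu : (ψ 0 u).1 = u.1 := by rw [hψ0]
  have hdet : 0 < (1 + (wishartScale β t α).1 * u.1).det :=
    det_one_add_mul_pos_of_posSemidef (wishartScale β t α).2 u.2
  have hφt : φ t u = p * Real.log (1 + (wishartScale β t α).1 * u.1).det :=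
    riccati_integral u.2 hψu hψ' (hφ0 u) (hφ u) t.2
  have hψt : (ψ t u).1 = NormedSpace.exp ((t : ℝ) • βᵀ) *
      (u.1 * (1 + (wishartScale β t α).1 * u.1)⁻¹) * NormedSpace.exp ((t : ℝ) • β) :=
    riccati_solution u.2 hψu hψ' t.2
  have hpairing : (ψ t u).pairing x =
      (u.1 * (1 + (wishartScale β t α).1 * u.1)⁻¹ * (wishartFlow β t x).1).trace := by
    rw [PSDCone.pairing, hψt, wishartFlow, ← Matrix.mul_assoc _ _ (NormedSpace.exp _),
      Matrix.trace_mul_comm _ (NormedSpace.exp _)]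
    simp only [Matrix.mul_assoc]
  rw [integral_map hmeas (f := fun ξ => Real.exp (-(u.pairing ξ)))
    (PSDCone.expNegPairing u).continuous.aestronglyMeasurable, haff.affine, hφt, hpairing,
    sub_eq_add_neg, Real.exp_add, Real.rpow_def_of_pos hdet]
  ring_nf

section Gaussian

variable {n : Type*} [Fintype n]

theorem lintegral_exp_neg_dotProduct_self (n : Type*) [Fintype n] :
    ∫⁻ y : n → ℝ, ENNReal.ofReal (Real.exp (-(y ⬝ᵥ y))) =
      ENNReal.ofReal (√Real.pi ^ Fintype.card n) := by
  have hprod : (fun y : n → ℝ => Real.exp (-(y ⬝ᵥ y))) =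
      fun y => ∏ i, Real.exp (-1 * y i ^ 2) := by
    funext y
    rw [← Real.exp_sum, dotProduct, ← Finset.sum_neg_distrib]
    exact congrArg Real.exp (Finset.sum_congr rfl fun i _ => by ring)
  rw [← ofReal_integral_eq_lintegral_ofReal _ (.of_forall fun y => (Real.exp_pos _).le), hprod,
    integral_fintype_prod_volume_eq_pow (ι := n) fun x : ℝ => Real.exp (-1 * x ^ 2),
    integral_gaussian, div_one]
  rw [hprod]
  exact Integrable.fintype_prod fun _ => integrable_exp_neg_mul_sq one_pos

theorem dotProduct_mulVec_comm_of_isHermitian {a : Matrix n n ℝ} (ha : a.IsHermitian)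
    (x y : n → ℝ) : x ⬝ᵥ a *ᵥ y = y ⬝ᵥ a *ᵥ x := by
  rw [Matrix.dotProduct_mulVec, ← Matrix.mulVec_transpose,
    ← Matrix.conjTranspose_eq_transpose_of_trivial, ha.eq, dotProduct_comm]

variable [DecidableEq n]

theorem lintegral_comp_mulVec_sub {r : Matrix n n ℝ} (hr : r.det ≠ 0) (e : n → ℝ)
    {f : (n → ℝ) → ℝ≥0∞} (hf : Measurable f) :
    ∫⁻ b, f (r *ᵥ b - e) = ENNReal.ofReal |r.det|⁻¹ * ∫⁻ y, f y := by
  have hmeas : Measurable (Matrix.toLin' r) :=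
    (LinearMap.continuous_of_finiteDimensional (Matrix.toLin' r)).measurable
  calc ∫⁻ b, f (r *ᵥ b - e)
      = ∫⁻ y, f (y - e) ∂(volume.map (Matrix.toLin' r)) :=
        (lintegral_map (hf.comp (measurable_id.sub_const e)) hmeas).symm
    _ = ENNReal.ofReal |r.det|⁻¹ * ∫⁻ y, f y := by
        rw [Real.map_matrix_volume_pi_eq_smul_volume_pi hr, lintegral_smul_measure,
          lintegral_sub_right_eq_self, abs_inv, smul_eq_mul]

theorem lintegral_exp_neg_quadratic {a : Matrix n n ℝ} (ha : a.PosDef) (c : n → ℝ) :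
    ∫⁻ b : n → ℝ, ENNReal.ofReal (Real.exp (-(b ⬝ᵥ a *ᵥ b) + 2 * (c ⬝ᵥ b))) =
      ENNReal.ofReal (√Real.pi ^ Fintype.card n * (√a.det)⁻¹ * Real.exp (c ⬝ᵥ a⁻¹ *ᵥ c)) := by
  obtain ⟨r, hr⟩ := exists_eq_conjTranspose_mul_self_of_posSemidef ha.posSemidef
  rw [Matrix.conjTranspose_eq_transpose_of_trivial] at hr
  have hdet : a.det = r.det * r.det := by rw [hr, Matrix.det_mul, Matrix.det_transpose]
  have hr0 : r.det ≠ 0 := left_ne_zero_of_mul (hdet ▸ ha.det_pos.ne')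
  obtain ⟨e, rfl⟩ : ∃ e, c = rᵀ *ᵥ e := ⟨rᵀ⁻¹ *ᵥ c, by
    rw [Matrix.mulVec_mulVec, Matrix.mul_nonsing_inv _ (by simpa using hr0), Matrix.one_mulVec]⟩
  have hadj (x y : n → ℝ) : rᵀ *ᵥ x ⬝ᵥ y = x ⬝ᵥ r *ᵥ y := by
    rw [Matrix.mulVec_transpose, Matrix.dotProduct_mulVec]
  have hinv : rᵀ *ᵥ e ⬝ᵥ a⁻¹ *ᵥ (rᵀ *ᵥ e) = e ⬝ᵥ e := by
    rw [hadj, hr, Matrix.mul_inv_rev, Matrix.mulVec_mulVec, Matrix.mulVec_mulVec,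
      ← Matrix.mul_assoc, Matrix.mul_nonsing_inv r hr0.isUnit, Matrix.one_mul,
      Matrix.nonsing_inv_mul _ (by simpa using hr0), Matrix.one_mulVec]
  have hsq (b : n → ℝ) : -(b ⬝ᵥ a *ᵥ b) + 2 * (rᵀ *ᵥ e ⬝ᵥ b) =
      e ⬝ᵥ e + -((r *ᵥ b - e) ⬝ᵥ (r *ᵥ b - e)) := by
    rw [hr, ← Matrix.mulVec_mulVec, dotProduct_comm b, hadj, hadj, sub_dotProduct, dotProduct_sub,
      dotProduct_sub, dotProduct_comm (r *ᵥ b) e]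
    ring
  simp_rw [hsq, Real.exp_add, ENNReal.ofReal_mul (Real.exp_pos _).le]
  rw [lintegral_const_mul _ (by fun_prop),
    lintegral_comp_mulVec_sub hr0 e (f := fun y => ENNReal.ofReal (Real.exp (-(y ⬝ᵥ y))))
      (by fun_prop), lintegral_exp_neg_dotProduct_self, hinv, hdet, Real.sqrt_mul_self_eq_abs,
    ← ENNReal.ofReal_mul (by positivity), ← ENNReal.ofReal_mul (by positivity)]
  congr 1
  ring

/-- The density of the normal distribution on `ℝⁿ` with mean `m` and covariance matrix `a / 2`, the
scaling for which the Gram matrix of `2 p` independent standard vectors is `Γ(p, 0; 1)`. -/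
noncomputable def gaussianDensity (a : Matrix n n ℝ) (m y : n → ℝ) : ℝ≥0∞ :=
  ENNReal.ofReal ((√Real.pi ^ Fintype.card n)⁻¹ * (√a.det)⁻¹ *
    Real.exp (-((y - m) ⬝ᵥ a⁻¹ *ᵥ (y - m))))

theorem lintegral_gaussianDensity_mul_exp_neg_quadratic {a v : Matrix n n ℝ} (ha : a.PosDef)
    (hv : (a⁻¹ + v).PosDef) (m k : n → ℝ) :
    ∫⁻ y, gaussianDensity a m y * ENNReal.ofReal (Real.exp (-(y ⬝ᵥ v *ᵥ y + 2 * (k ⬝ᵥ y)))) =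
      ENNReal.ofReal ((√a.det)⁻¹ * (√(a⁻¹ + v).det)⁻¹ *
        Real.exp ((a⁻¹ *ᵥ m - k) ⬝ᵥ (a⁻¹ + v)⁻¹ *ᵥ (a⁻¹ *ᵥ m - k) - m ⬝ᵥ a⁻¹ *ᵥ m)) := by
  have hexp (y : n → ℝ) : -((y - m) ⬝ᵥ a⁻¹ *ᵥ (y - m)) + -(y ⬝ᵥ v *ᵥ y + 2 * (k ⬝ᵥ y)) =
      -(m ⬝ᵥ a⁻¹ *ᵥ m) + (-(y ⬝ᵥ (a⁻¹ + v) *ᵥ y) + 2 * ((a⁻¹ *ᵥ m - k) ⬝ᵥ y)) := by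
    simp only [Matrix.mulVec_sub, sub_dotProduct, dotProduct_sub, Matrix.add_mulVec, dotProduct_add,
      dotProduct_mulVec_comm_of_isHermitian ha.inv.1 m y, dotProduct_comm (a⁻¹ *ᵥ m) y]
    ring
  have hterm (y : n → ℝ) : gaussianDensity a m y *
        ENNReal.ofReal (Real.exp (-(y ⬝ᵥ v *ᵥ y + 2 * (k ⬝ᵥ y)))) =
      ENNReal.ofReal ((√Real.pi ^ Fintype.card n)⁻¹ * (√a.det)⁻¹ *
        Real.exp (-(m ⬝ᵥ a⁻¹ *ᵥ m))) *
      ENNReal.ofReal (Real.exp (-(y ⬝ᵥ (a⁻¹ + v) *ᵥ y) + 2 * ((a⁻¹ *ᵥ m - k) ⬝ᵥ y))) := by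
    rw [gaussianDensity, ← ENNReal.ofReal_mul (by positivity), ← ENNReal.ofReal_mul (by positivity),
      mul_assoc, ← Real.exp_add, hexp, Real.exp_add, mul_assoc, mul_assoc, mul_assoc]
  simp_rw [hterm]
  rw [lintegral_const_mul _ (by fun_prop), lintegral_exp_neg_quadratic hv,
    ← ENNReal.ofReal_mul (by positivity), sub_eq_add_neg _ (m ⬝ᵥ _), Real.exp_add]
  congr 1
  field_simp

theorem lintegral_gaussianDensity_one_mul_exp {v : Matrix n n ℝ} (hv : v.PosSemidef)
    (k : n → ℝ) :
    ∫⁻ y, gaussianDensity 1 0 y * ENNReal.ofReal (Real.exp (-(y ⬝ᵥ v *ᵥ y + 2 * (k ⬝ᵥ y)))) =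
      ENNReal.ofReal ((√(1 + v).det)⁻¹ * Real.exp (k ⬝ᵥ (1 + v)⁻¹ *ᵥ k)) := by
  have h := lintegral_gaussianDensity_mul_exp_neg_quadratic Matrix.PosDef.one
    (by simpa using Matrix.PosDef.one.add_posSemidef hv) 0 k
  simpa [Matrix.mulVec_neg] using h

theorem lintegral_gaussianDensity_mul_exp {a : Matrix n n ℝ} (ha : a.PosDef) (m k : n → ℝ) {h : ℝ}
    (hh : 0 < 1 + h) :
    ∫⁻ y, gaussianDensity a m y *
        ENNReal.ofReal (Real.exp (-(h * (y ⬝ᵥ a⁻¹ *ᵥ y) + 2 * (k ⬝ᵥ y)))) =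
      ENNReal.ofReal ((√(1 + h) ^ Fintype.card n)⁻¹ *
        Real.exp ((1 + h)⁻¹ * (k ⬝ᵥ a *ᵥ k - 2 * (k ⬝ᵥ m) - h * (m ⬝ᵥ a⁻¹ *ᵥ m)))) := by
  have hdet : IsUnit a.det := ha.det_pos.ne'.isUnit
  have hprec : a⁻¹ + h • a⁻¹ = (1 + h) • a⁻¹ := by rw [add_smul, one_smul]
  have hcov : ((1 + h) • a⁻¹)⁻¹ = (1 + h)⁻¹ • a := by
    refine Matrix.inv_eq_right_inv ?_
    rw [Matrix.smul_mul, Matrix.mul_smul, smul_smul, Matrix.nonsing_inv_mul a hdet,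
      mul_inv_cancel₀ hh.ne', one_smul]
  have hscale : (√a.det)⁻¹ * (√((1 + h) • a⁻¹).det)⁻¹ = (√(1 + h) ^ Fintype.card n)⁻¹ := by
    rw [Matrix.det_smul, Matrix.det_nonsing_inv, Ring.inverse_eq_inv',
      Real.sqrt_mul (pow_nonneg hh.le _), Real.sqrt_inv, mul_inv, inv_inv, mul_left_comm,
      inv_mul_cancel₀ (Real.sqrt_pos.2 ha.det_pos).ne', mul_one,
      ← Real.sqrt_sq (pow_nonneg (Real.sqrt_nonneg (1 + h)) _), ← pow_mul, mul_comm _ 2, pow_mul,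
      Real.sq_sqrt hh.le]
  have ham : a *ᵥ (a⁻¹ *ᵥ m) = m := by
    rw [Matrix.mulVec_mulVec, Matrix.mul_nonsing_inv a hdet, Matrix.one_mulVec]
  have hexp : (a⁻¹ *ᵥ m - k) ⬝ᵥ ((1 + h)⁻¹ • a) *ᵥ (a⁻¹ *ᵥ m - k) - m ⬝ᵥ a⁻¹ *ᵥ m =
      (1 + h)⁻¹ * (k ⬝ᵥ a *ᵥ k - 2 * (k ⬝ᵥ m) - h * (m ⬝ᵥ a⁻¹ *ᵥ m)) := by
    simp only [Matrix.smul_mulVec, dotProduct_smul, Matrix.mulVec_sub, ham, sub_dotProduct,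
      dotProduct_sub, dotProduct_mulVec_comm_of_isHermitian ha.1 (a⁻¹ *ᵥ m) k,
      dotProduct_comm (a⁻¹ *ᵥ m) m, smul_eq_mul]
    field_simp
    ring
  have hint := lintegral_gaussianDensity_mul_exp_neg_quadratic ha
    (hprec ▸ ha.inv.smul hh : (a⁻¹ + h • a⁻¹).PosDef) m k
  rw [hprec, hcov, hexp, hscale] at hint
  simpa only [Matrix.smul_mulVec, dotProduct_smul, smul_eq_mul] using hint

end Gaussian

section NoncentralGamma

/-- The density of the non-central gamma distribution with shape `q` and non-centrality `l`, as a
Poisson mixture of gamma densities. -/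
noncomputable def noncentralGammaPDF (q l x : ℝ) : ℝ≥0∞ :=
  ∑' k : ℕ, ENNReal.ofReal (Real.exp (-l) * (l ^ k / k.factorial)) * gammaPDF (q + k) 1 x

theorem measurable_noncentralGammaPDF (q : ℝ) :
    Measurable fun z : ℝ × ℝ => noncentralGammaPDF q z.1 z.2 :=
  Measurable.tsum fun _ => Measurable.fun_mul (by fun_prop)
    (ENNReal.measurable_ofReal.comp ((measurable_gammaPDFReal _ _).comp measurable_snd))

theorem noncentralGammaPDF_of_neg (q l : ℝ) {x : ℝ} (hx : x < 0) :
    noncentralGammaPDF q l x = 0 := by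
  simp [noncentralGammaPDF, gammaPDF_of_neg hx]

theorem gammaPDF_mul_exp {h : ℝ} (hh : 0 < 1 + h) (a x : ℝ) :
    gammaPDF a 1 x * ENNReal.ofReal (Real.exp (-(h * x))) =
      ENNReal.ofReal ((1 + h) ^ (-a)) * gammaPDF a (1 + h) x := by
  rcases lt_or_ge x 0 with hx | hx
  · simp [gammaPDF_of_neg hx]
  · have hpow : (1 + h) ^ (-a) * (1 + h) ^ a = 1 := by
      rw [← Real.rpow_add hh, neg_add_cancel, Real.rpow_zero]
    have hexp : Real.exp (-((1 + h) * x)) = Real.exp (-(1 * x)) * Real.exp (-(h * x)) := by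
      rw [← Real.exp_add, ← neg_add, add_mul]
    rw [gammaPDF_of_nonneg hx, gammaPDF_of_nonneg hx, ← ENNReal.ofReal_mul' (Real.exp_pos _).le,
      ← ENNReal.ofReal_mul (by positivity), hexp, Real.one_rpow]
    congr 1
    linear_combination (-(1 / Real.Gamma a * x ^ (a - 1) *
      (Real.exp (-(1 * x)) * Real.exp (-(h * x))))) * hpow

theorem lintegral_gammaPDF_mul_exp {a h : ℝ} (ha : 0 < a) (hh : 0 < 1 + h) :
    ∫⁻ x, gammaPDF a 1 x * ENNReal.ofReal (Real.exp (-(h * x))) =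
      ENNReal.ofReal ((1 + h) ^ (-a)) := by
  have hmeas : Measurable (gammaPDF a (1 + h)) := (measurable_gammaPDFReal _ _).ennreal_ofReal
  simp_rw [gammaPDF_mul_exp hh]
  rw [lintegral_const_mul _ hmeas, lintegral_gammaPDF_eq_one ha hh, mul_one]

theorem hasSum_poisson_mul_rpow (q l : ℝ) {h : ℝ} (hh : 0 < 1 + h) :
    HasSum (fun k : ℕ => Real.exp (-l) * (l ^ k / k.factorial) * (1 + h) ^ (-(q + k)))
      ((1 + h) ^ (-q) * Real.exp (-(h / (1 + h) * l))) := by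
  have hsum := (NormedSpace.expSeries_div_hasSum_exp (l / (1 + h))).mul_left
    (Real.exp (-l) * (1 + h) ^ (-q))
  rw [← Real.exp_eq_exp_ℝ] at hsum
  convert! hsum using 1
  · funext k
    rw [neg_add, Real.rpow_add hh, Real.rpow_neg hh.le (k : ℝ), Real.rpow_natCast, div_pow]
    field_simp
  · rw [mul_comm (Real.exp (-l)), mul_assoc, ← Real.exp_add]
    congr 2
    field_simp
    ring

theorem lintegral_noncentralGammaPDF_mul_exp {q l h : ℝ} (hq : 0 < q) (hl : 0 ≤ l)
    (hh : 0 < 1 + h) :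
    ∫⁻ x, noncentralGammaPDF q l x * ENNReal.ofReal (Real.exp (-(h * x))) =
      ENNReal.ofReal ((1 + h) ^ (-q) * Real.exp (-(h / (1 + h) * l))) := by
  have hmeas (k : ℕ) : Measurable fun x =>
      gammaPDF (q + k) 1 x * ENNReal.ofReal (Real.exp (-(h * x))) :=
    (measurable_gammaPDFReal _ _).ennreal_ofReal.fun_mul (by fun_prop)
  have hsum := hasSum_poisson_mul_rpow q l hh
  simp_rw [noncentralGammaPDF, ← ENNReal.tsum_mul_right, mul_assoc]
  rw [lintegral_tsum fun k => ((hmeas k).const_mul _).aemeasurable, ← hsum.tsum_eq,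
    ENNReal.ofReal_tsum_of_nonneg (fun k => by positivity) hsum.summable]
  refine tsum_congr fun k => ?_
  rw [lintegral_const_mul _ (hmeas k), lintegral_gammaPDF_mul_exp (by positivity) hh,
    ← ENNReal.ofReal_mul (by positivity)]

end NoncentralGamma

section BorderedMatrix

variable {n : Type*}

/-- The symmetric extension of `a` by a last column `b` and a corner entry `c`. -/
def borderedMatrix (a : Matrix n n ℝ) (b : n → ℝ) (c : ℝ) : Matrix (n ⊕ Unit) (n ⊕ Unit) ℝ :=
  Matrix.fromBlocks a (Matrix.replicateCol Unit b) (Matrix.replicateRow Unit b)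
    (Matrix.diagonal fun _ => c)

theorem one_add_borderedMatrix [DecidableEq n] (a : Matrix n n ℝ) (b : n → ℝ) (c : ℝ) :
    1 + borderedMatrix a b c = borderedMatrix (1 + a) b (1 + c) := by
  ext (i | i) (j | j) <;> simp [borderedMatrix, Matrix.one_apply]

theorem replicateCol_mul_inv_diagonal_mul_replicateRow (k : n → ℝ) (c : ℝ) :
    Matrix.replicateCol Unit k * (Matrix.diagonal fun _ : Unit => c)⁻¹ *
      Matrix.replicateRow Unit k = c⁻¹ • Matrix.vecMulVec k k := by
  ext i j
  simp [Matrix.mul_apply, Matrix.vecMulVec_apply, mul_comm _ c⁻¹, mul_assoc]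

variable [Fintype n]

theorem trace_borderedMatrix_mul (a a' : Matrix n n ℝ) (b b' : n → ℝ) (c c' : ℝ) :
    (borderedMatrix a b c * borderedMatrix a' b' c').trace =
      (a * a').trace + 2 * (b ⬝ᵥ b') + c * c' := by
  simp only [borderedMatrix, Matrix.fromBlocks_multiply, ← Matrix.vecMulVec_eq, Matrix.trace,
    Matrix.diag_apply, Fintype.sum_sum_type, Matrix.fromBlocks_apply₁₁, Matrix.fromBlocks_apply₂₂,
    Matrix.add_apply, Matrix.vecMulVec_apply, Matrix.replicateRow_mul_replicateCol_apply,
    Matrix.diagonal_mul_diagonal, Matrix.diagonal_apply_eq, Finset.sum_add_distrib,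
    Fintype.sum_unique, dotProduct]
  ring

theorem dotProduct_vecMulVec_mulVec (b v : n → ℝ) :
    v ⬝ᵥ Matrix.vecMulVec b b *ᵥ v = (b ⬝ᵥ v) ^ 2 := by
  rw [Matrix.vecMulVec_mulVec, dotProduct_smul, dotProduct_comm v b]
  simp [pow_two]

variable [DecidableEq n]

theorem dotProduct_inv_mulVec_le_one {s : Matrix n n ℝ} (hs : s.PosDef) (w : n → ℝ) :
    w ⬝ᵥ (s + Matrix.vecMulVec w w)⁻¹ *ᵥ w ≤ 1 := by
  have ha : (s + Matrix.vecMulVec w w).PosDef := hs.add_posSemidef (posSemidef_vecMulVec_self w)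
  obtain ⟨y, hy⟩ : ∃ y, y = (s + Matrix.vecMulVec w w)⁻¹ *ᵥ w := ⟨_, rfl⟩
  have hw : (s + Matrix.vecMulVec w w) *ᵥ y = w := by
    rw [hy, Matrix.mulVec_mulVec, Matrix.mul_nonsing_inv _ ha.det_pos.ne'.isUnit, Matrix.one_mulVec]
  have hsplit : y ⬝ᵥ s *ᵥ y + (w ⬝ᵥ y) ^ 2 = w ⬝ᵥ y := by
    rw [← dotProduct_vecMulVec_mulVec, ← dotProduct_add, ← Matrix.add_mulVec, hw, dotProduct_comm]
  have hnonneg : 0 ≤ y ⬝ᵥ s *ᵥ y := by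
    simpa using hs.posSemidef.dotProduct_mulVec_nonneg y
  rw [← hy]
  nlinarith

theorem borderedMatrix_posDef {a : Matrix n n ℝ} (ha : a.PosDef) (b : n → ℝ) {s : ℝ} (hs : 0 < s) :
    (borderedMatrix a b (b ⬝ᵥ a⁻¹ *ᵥ b + s)).PosDef := by
  let _ : Invertible a := a.invertibleOfIsUnitDet ha.det_pos.ne'.isUnit
  have hschur : (Matrix.diagonal fun _ : Unit => b ⬝ᵥ a⁻¹ *ᵥ b + s) -
      Matrix.replicateRow Unit b * a⁻¹ * Matrix.replicateCol Unit b =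
        Matrix.diagonal fun _ => s := by
    ext
    rw [Matrix.mul_assoc, ← Matrix.replicateCol_mulVec]
    simp [Matrix.replicateRow_mul_replicateCol_apply]
  have hdet : (borderedMatrix a b (b ⬝ᵥ a⁻¹ *ᵥ b + s)).det = a.det * s := by
    rw [borderedMatrix, Matrix.det_fromBlocks₁₁, Matrix.invOf_eq_nonsing_inv, hschur,
      Matrix.det_diagonal, Finset.prod_const, Finset.card_univ, Fintype.card_unit, pow_one]
  have hpsd : (borderedMatrix a b (b ⬝ᵥ a⁻¹ *ᵥ b + s)).PosSemidef := by
    refine (Matrix.PosDef.fromBlocks₁₁ (Matrix.replicateCol Unit b) _ ha).2 ?_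
    rw [Matrix.conjTranspose_replicateCol, star_trivial, hschur]
    exact .diagonal fun _ => hs.le
  exact hpsd.posDef_iff_det_ne_zero.2 (hdet ▸ (mul_pos ha.det_pos hs).ne')

theorem exists_eq_borderedMatrix_of_posSemidef {n : Type*} [Finite n]
    {u : Matrix (n ⊕ Unit) (n ⊕ Unit) ℝ} (hu : u.PosSemidef) :
    ∃ (v : Matrix n n ℝ) (k : n → ℝ) (h : ℝ), v.PosSemidef ∧ 0 ≤ h ∧
      u = borderedMatrix (v + (1 + h)⁻¹ • Matrix.vecMulVec k k) k h := by
  classical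
  cases nonempty_fintype n
  obtain ⟨a, k, h, rfl⟩ : ∃ a k h, u = borderedMatrix a k h :=
    ⟨u.toBlocks₁₁, fun i => u (.inl i) (.inr ()), u (.inr ()) (.inr ()), by
      ext (i | i) (j | j)
      exacts [rfl, rfl, (hu.1.apply (.inr i) (.inl j)).symm, rfl]⟩
  have hh : 0 ≤ h := by simpa [borderedMatrix] using hu.diag_nonneg (i := Sum.inr ())
  refine ⟨a - (1 + h)⁻¹ • Matrix.vecMulVec k k, k, h, ?_, hh, by rw [sub_add_cancel]⟩
  have hD : (Matrix.diagonal fun _ : Unit => 1 + h).PosDef := .diagonal fun _ => by positivity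
  let _ : Invertible (Matrix.diagonal fun _ : Unit => 1 + h) :=
    Matrix.invertibleOfIsUnitDet _ hD.det_pos.ne'.isUnit
  have hadd : (borderedMatrix a k (1 + h)).PosSemidef := by
    have hsum := hu.add (Matrix.PosSemidef.diagonal (d := Sum.elim (fun _ : n => 0) fun _ => 1)
      (by rintro (i | i) <;> simp))
    convert! hsum using 1
    ext (i | i) (j | j) <;> simp [borderedMatrix, Matrix.diagonal_apply, add_comm]
  have hschur := (Matrix.PosDef.fromBlocks₂₂ a (Matrix.replicateCol Unit k) hD).1 (by
    rwa [Matrix.conjTranspose_replicateCol, star_trivial])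
  rwa [Matrix.conjTranspose_replicateCol, star_trivial,
    replicateCol_mul_inv_diagonal_mul_replicateRow] at hschur

section SchurComplement

variable {v : Matrix n n ℝ} (k : n → ℝ) {h : ℝ}

theorem inv_one_add_borderedMatrix (hv : v.PosSemidef) (hh : 1 + h ≠ 0) :
    (1 + borderedMatrix (v + (1 + h)⁻¹ • Matrix.vecMulVec k k) k h)⁻¹ =
      borderedMatrix (1 + v)⁻¹ (-(1 + h)⁻¹ • (1 + v)⁻¹ *ᵥ k)
        ((1 + h)⁻¹ + (1 + h)⁻¹ ^ 2 * (k ⬝ᵥ (1 + v)⁻¹ *ᵥ k)) := by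
  have hy := Matrix.PosDef.one.add_posSemidef hv
  have hyy := Matrix.mul_nonsing_inv (1 + v) hy.det_pos.ne'.isUnit
  have hk : (1 + v) *ᵥ ((1 + v)⁻¹ *ᵥ k) = k := by rw [Matrix.mulVec_mulVec, hyy, Matrix.one_mulVec]
  have hky : k ᵥ* (1 + v)⁻¹ = (1 + v)⁻¹ *ᵥ k := by
    rw [← Matrix.mulVec_transpose, ← Matrix.conjTranspose_eq_transpose_of_trivial, hy.inv.1.eq]
  refine Matrix.inv_eq_right_inv ?_
  rw [one_add_borderedMatrix, ← add_assoc, borderedMatrix, borderedMatrix,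
    Matrix.fromBlocks_multiply, ← Matrix.fromBlocks_one]
  congr 1
  · rw [Matrix.add_mul, hyy, Matrix.smul_mul, Matrix.vecMulVec_mul, hky, ← Matrix.vecMulVec_eq,
      Matrix.vecMulVec_smul, neg_smul, add_neg_cancel_right]
  · rw [← Matrix.replicateCol_mulVec, Matrix.mulVec_smul, Matrix.add_mulVec, hk, Matrix.smul_mulVec,
      Matrix.vecMulVec_mulVec]
    ext i
    simp only [Matrix.add_apply, Matrix.mul_diagonal, Matrix.replicateCol_apply, Pi.add_apply,
      Pi.smul_apply, smul_eq_mul, op_smul_eq_smul, Matrix.zero_apply]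
    field_simp
    ring
  · rw [← Matrix.replicateRow_vecMul, hky]
    ext _ j
    simp only [Matrix.add_apply, Matrix.diagonal_mul, Matrix.replicateRow_apply, Pi.smul_apply,
      smul_eq_mul, Matrix.zero_apply]
    field_simp
    ring
  · ext
    rw [Matrix.add_apply, Matrix.replicateRow_mul_replicateCol_apply, dotProduct_smul,
      Matrix.diagonal_mul_diagonal, Matrix.diagonal_apply_eq, Matrix.one_apply_eq, smul_eq_mul]
    field_simp
    ring

theorem det_one_add_borderedMatrix (hh : 1 + h ≠ 0) :
    (1 + borderedMatrix (v + (1 + h)⁻¹ • Matrix.vecMulVec k k) k h).det =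
      (1 + h) * (1 + v).det := by
  let _ : Invertible (Matrix.diagonal fun _ : Unit => 1 + h) :=
    Matrix.invertibleOfIsUnitDet _ (by simpa using hh)
  rw [one_add_borderedMatrix, borderedMatrix, Matrix.det_fromBlocks₂₂, Matrix.det_diagonal,
    Finset.prod_const, Finset.card_univ, Fintype.card_unit, pow_one, Matrix.invOf_eq_nonsing_inv,
    replicateCol_mul_inv_diagonal_mul_replicateRow, ← add_assoc, add_sub_cancel_right]

theorem trace_mul_inv_one_add (hv : v.PosSemidef) (ω : Matrix n n ℝ) :
    (v * (1 + v)⁻¹ * ω).trace = ω.trace - ((1 + v)⁻¹ * ω).trace := by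
  have hdet : IsUnit (1 + v).det := (Matrix.PosDef.one.add_posSemidef hv).det_pos.ne'.isUnit
  have hres : (1 + v)⁻¹ + v * (1 + v)⁻¹ = 1 := by
    simpa only [Matrix.add_mul, Matrix.one_mul] using Matrix.mul_nonsing_inv (1 + v) hdet
  rw [eq_sub_of_add_eq' hres, Matrix.sub_mul, Matrix.one_mul, Matrix.trace_sub]

end SchurComplement

theorem trace_mul_inv_one_add_borderedMatrix {v : Matrix n n ℝ} (hv : v.PosSemidef) (k : n → ℝ)
    {h : ℝ} (hh : 1 + h ≠ 0)
    (hu : (borderedMatrix (v + (1 + h)⁻¹ • Matrix.vecMulVec k k) k h).PosSemidef)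
    (ω : Matrix n n ℝ) (l : ℝ) :
    (borderedMatrix (v + (1 + h)⁻¹ • Matrix.vecMulVec k k) k h *
        (1 + borderedMatrix (v + (1 + h)⁻¹ • Matrix.vecMulVec k k) k h)⁻¹ *
        borderedMatrix ω 0 l).trace =
      (v * (1 + v)⁻¹ * ω).trace +
        l * (h / (1 + h) - (1 + h)⁻¹ ^ 2 * (k ⬝ᵥ (1 + v)⁻¹ *ᵥ k)) := by
  have htrace : (borderedMatrix ω 0 l).trace = ω.trace + l := by
    simp [borderedMatrix, Matrix.trace]
  rw [trace_mul_inv_one_add hu, trace_mul_inv_one_add hv, inv_one_add_borderedMatrix k hv hh,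
    trace_borderedMatrix_mul, htrace, dotProduct_zero]
  field_simp
  ring

end BorderedMatrix

section SymmetricCoordinates

theorem quasiMeasurePreserving_of_surjective {E F : Type*} [NormedAddCommGroup E]
    [NormedSpace ℝ E] [MeasurableSpace E] [BorelSpace E] [FiniteDimensional ℝ E]
    [NormedAddCommGroup F] [NormedSpace ℝ F] [MeasurableSpace F] [BorelSpace F]
    (L : E →ₗ[ℝ] F) (hL : Function.Surjective L) (μ : Measure E) [μ.IsAddHaarMeasure]
    (ν : Measure F) [ν.IsAddHaarMeasure] : Measure.QuasiMeasurePreserving L μ ν := by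
  obtain ⟨c, -, hc⟩ := L.exists_map_addHaar_eq_smul_addHaar μ ν hL
  exact ⟨L.continuous_of_finiteDimensional.measurable,
    by rw [hc]; exact Measure.smul_absolutelyContinuous⟩

variable {n : Type*}

/-- The symmetric matrix with prescribed entries on the unordered pairs of indices; this gives
coordinates on symmetric matrices that do not depend on an order of the index set. -/
def symMatrix : (Sym2 n → ℝ) →ₗ[ℝ] Matrix n n ℝ where
  toFun v := .of fun i j => v s(i, j)
  map_add' _ _ := rfl
  map_smul' _ _ := rfl

theorem symMatrix_apply (v : Sym2 n → ℝ) (i j : n) : symMatrix v i j = v s(i, j) := rfl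

/-- The coordinates of the symmetric part of a matrix, a left inverse of `symMatrix`. -/
noncomputable def symCoords : Matrix n n ℝ →ₗ[ℝ] (Sym2 n → ℝ) where
  toFun x q := q.lift ⟨fun i j => (x i j + x j i) / 2, fun i j => by simp only [add_comm]⟩
  map_add' x y := by
    ext ⟨i, j⟩
    simp only [Sym2.lift_mk, Matrix.add_apply, Pi.add_apply]
    ring
  map_smul' r x := by
    ext ⟨i, j⟩
    simp only [Sym2.lift_mk, Matrix.smul_apply, Pi.smul_apply, smul_eq_mul, RingHom.id_apply]
    ring

theorem symCoords_symMatrix (v : Sym2 n → ℝ) : symCoords (symMatrix v) = v := by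
  ext ⟨i, j⟩
  change (v s(i, j) + v s(j, i)) / 2 = v s(i, j)
  rw [Sym2.eq_swap, add_self_div_two]

theorem symMatrix_symCoords {x : Matrix n n ℝ} (hx : x.IsSymm) : symMatrix (symCoords x) = x := by
  ext i j
  change (x i j + x j i) / 2 = x i j
  rw [hx.apply, add_self_div_two]

theorem isSymm_symMatrix (v : Sym2 n → ℝ) : (symMatrix v).IsSymm := by
  ext i j
  rw [Matrix.transpose_apply, symMatrix_apply, symMatrix_apply, Sym2.eq_swap]

theorem continuous_symMatrix : Continuous (symMatrix (n := n)) :=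
  continuous_matrix fun i j => continuous_apply s(i, j)

theorem measurable_exp_neg_trace_mul_symMatrix [Fintype n] (u : Matrix n n ℝ) :
    Measurable fun v => ENNReal.ofReal (Real.exp (-(u * symMatrix v).trace)) :=
  (Real.continuous_exp.comp
    (continuous_const.matrix_mul continuous_symMatrix).matrix_trace.neg).measurable.ennreal_ofReal

theorem continuous_symCoords : Continuous (symCoords (n := n)) :=
  continuous_pi <| by
    rintro ⟨i, j⟩
    exact ((continuous_id.matrix_elem i j).add (continuous_id.matrix_elem j i)).div_const 2

/-- The congruence `x ↦ g x gᵀ` in coordinates. -/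
noncomputable def congrCoords {m : Type*} [Fintype n] (g : Matrix m n ℝ) :
    (Sym2 n → ℝ) →ₗ[ℝ] (Sym2 m → ℝ) :=
  symCoords ∘ₗ mulRightLinearMap m ℝ gᵀ ∘ₗ mulLeftLinearMap n ℝ g ∘ₗ symMatrix

theorem symMatrix_congrCoords {m : Type*} [Fintype n] (g : Matrix m n ℝ) (v : Sym2 n → ℝ) :
    symMatrix (congrCoords g v) = g * symMatrix v * gᵀ := by
  refine symMatrix_symCoords (x := g * symMatrix v * gᵀ) ?_
  rw [Matrix.IsSymm, Matrix.transpose_mul, Matrix.transpose_mul, isSymm_symMatrix,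
    Matrix.transpose_transpose, Matrix.mul_assoc]

theorem surjective_congrCoords {m : Type*} [Finite m] [DecidableEq m] [Fintype n]
    {g : Matrix m n ℝ} {h : Matrix n m ℝ} (hgh : g * h = 1) :
    Function.Surjective (congrCoords g) := fun v => by
  cases nonempty_fintype m
  refine ⟨congrCoords h v, ?_⟩
  rw [← symCoords_symMatrix (congrCoords g _), symMatrix_congrCoords, symMatrix_congrCoords,
    show g * (h * symMatrix v * hᵀ) * gᵀ = (g * h) * symMatrix v * (g * h)ᵀ by
      simp only [Matrix.transpose_mul, Matrix.mul_assoc],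
    hgh, Matrix.transpose_one, Matrix.one_mul, Matrix.mul_one, symCoords_symMatrix]

/-- The coordinates of a symmetric matrix bordered by a column and a corner entry. -/
noncomputable def borderedCoords : ((Sym2 n → ℝ) × (n → ℝ)) × ℝ →ₗ[ℝ] (Sym2 (n ⊕ Unit) → ℝ) where
  toFun z := symCoords (borderedMatrix (symMatrix z.1.1) z.1.2 z.2)
  map_add' y z := by
    rw [← map_add]
    congr 1
    ext (i | i) (j | j) <;> simp [borderedMatrix]
  map_smul' r z := by
    rw [RingHom.id_apply, ← map_smul]
    congr 1
    ext (i | i) (j | j) <;> simp [borderedMatrix]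

theorem symMatrix_borderedCoords (v : Sym2 n → ℝ) (b : n → ℝ) (c : ℝ) :
    symMatrix (borderedCoords ((v, b), c)) = borderedMatrix (symMatrix v) b c := by
  refine symMatrix_symCoords ?_
  rw [borderedMatrix, Matrix.IsSymm, Matrix.fromBlocks_transpose, isSymm_symMatrix,
    Matrix.transpose_replicateCol, Matrix.transpose_replicateRow, Matrix.diagonal_transpose]

theorem surjective_borderedCoords : Function.Surjective (borderedCoords (n := n)) := fun v => by
  refine ⟨((fun q => v (q.map .inl), fun i => v s(.inl i, .inr ())), v s(.inr (), .inr ())), ?_⟩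
  rw [← symCoords_symMatrix (borderedCoords _), symMatrix_borderedCoords]
  conv_rhs => rw [← symCoords_symMatrix v]
  congr 1
  ext (i | i) (j | j)
  exacts [rfl, rfl, congrArg v Sym2.eq_swap, rfl]

end SymmetricCoordinates

section WishartCoords

variable {m n : Type*} [Fintype m] [DecidableEq m] [Fintype n] [DecidableEq n]

/-- `μ` is, in the coordinates of `symMatrix`, an absolutely continuous law on the positive definite
matrices with the Laplace transform of the non-central Wishart distribution `Γ(p, ω; σ)`. -/
structure IsWishartCoords (p : ℝ) (ω σ : Matrix n n ℝ) (μ : Measure (Sym2 n → ℝ)) : Prop where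
  absolutelyContinuous : μ ≪ volume
  posDef : ∀ᵐ v ∂μ, (symMatrix v).PosDef
  laplace : ∀ u : Matrix n n ℝ, u.PosSemidef →
    ∫⁻ v, ENNReal.ofReal (Real.exp (-(u * symMatrix v).trace)) ∂μ =
      ENNReal.ofReal ((1 + σ * u).det ^ (-p) * Real.exp (-(u * (1 + σ * u)⁻¹ * ω).trace))

theorem measurableSet_setOf_symMatrix_posDef {n : Type*} [Finite n] :
    MeasurableSet {v : Sym2 n → ℝ | (symMatrix v).PosDef} := by
  classical
  cases nonempty_fintype n
  have hset : {v : Sym2 n → ℝ | (symMatrix v).PosDef} =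
      symMatrix ⁻¹' {x | x.PosSemidef} ∩ {v | (symMatrix v).det ≠ 0} := by
    ext v
    exact ⟨fun hv => ⟨hv.posSemidef, hv.det_pos.ne'⟩, fun hv => hv.1.posDef_iff_det_ne_zero.2 hv.2⟩
  rw [hset]
  exact (isClosed_setOf_posSemidef.preimage continuous_symMatrix).measurableSet.inter
    (isOpen_ne_fun continuous_symMatrix.matrix_det continuous_const).measurableSet

theorem det_one_add_congruence (g : Matrix m n ℝ) (σ : Matrix n n ℝ) (u : Matrix m m ℝ) :
    (1 + g * σ * gᵀ * u).det = (1 + σ * (gᵀ * u * g)).det := by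
  rw [show g * σ * gᵀ * u = g * (σ * gᵀ * u) by simp only [Matrix.mul_assoc],
    Matrix.det_one_add_mul_comm]
  simp only [Matrix.mul_assoc]

theorem trace_mul_inv_one_add_congruence (g : Matrix m n ℝ) {σ : Matrix n n ℝ} {u : Matrix m m ℝ}
    (h : (1 + σ * (gᵀ * u * g)).det ≠ 0) (ω : Matrix n n ℝ) :
    (u * (1 + g * σ * gᵀ * u)⁻¹ * (g * ω * gᵀ)).trace =
      (gᵀ * u * g * (1 + σ * (gᵀ * u * g))⁻¹ * ω).trace := by
  have hinv : (1 + g * σ * gᵀ * u)⁻¹ * g = g * (1 + σ * (gᵀ * u * g))⁻¹ := by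
    let _ := Matrix.invertibleOfIsUnitDet _ h.isUnit
    let _ := Matrix.invertibleOfIsUnitDet (1 + g * σ * gᵀ * u)
      (det_one_add_congruence g σ u ▸ h.isUnit)
    rw [Matrix.inv_mul_eq_iff_eq_mul_of_invertible, ← Matrix.mul_assoc, eq_comm,
      Matrix.mul_inv_eq_iff_eq_mul_of_invertible]
    simp only [Matrix.mul_add, Matrix.add_mul, Matrix.one_mul, Matrix.mul_one, Matrix.mul_assoc]
  calc (u * (1 + g * σ * gᵀ * u)⁻¹ * (g * ω * gᵀ)).trace
      = (u * ((1 + g * σ * gᵀ * u)⁻¹ * g) * ω * gᵀ).trace := by simp only [Matrix.mul_assoc]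
    _ = _ := by rw [hinv, Matrix.trace_mul_comm]; simp only [Matrix.mul_assoc]

namespace IsWishartCoords

variable {p : ℝ} {ω σ : Matrix n n ℝ} {μ : Measure (Sym2 n → ℝ)}

theorem isProbabilityMeasure (hμ : IsWishartCoords p ω σ μ) : IsProbabilityMeasure μ :=
  ⟨by simpa using hμ.laplace 0 .zero⟩

theorem map_congrCoords (hμ : IsWishartCoords p ω σ μ) (hσ : σ.PosSemidef) {g : Matrix m n ℝ}
    {h : Matrix n m ℝ} (hgh : g * h = 1) :
    IsWishartCoords p (g * ω * gᵀ) (g * σ * gᵀ) (μ.map (congrCoords g)) := by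
  have hq : Measure.QuasiMeasurePreserving (congrCoords g) :=
    quasiMeasurePreserving_of_surjective _ (surjective_congrCoords hgh) volume volume
  refine ⟨(hμ.absolutelyContinuous.map hq.measurable).trans hq.absolutelyContinuous, ?_,
    fun u hu => ?_⟩
  · rw [ae_map_iff hq.measurable.aemeasurable measurableSet_setOf_symMatrix_posDef]
    filter_upwards [hμ.posDef] with v hv
    rw [symMatrix_congrCoords, ← Matrix.conjTranspose_eq_transpose_of_trivial]
    have hinv : Function.LeftInverse (· ᵥ* h) (· ᵥ* g) := fun x => by
      simp only [Matrix.vecMul_vecMul, hgh, Matrix.vecMul_one]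
    exact hv.mul_mul_conjTranspose_same hinv.injective
  · have hu' : (gᵀ * u * g).PosSemidef := by simpa using hu.conjTranspose_mul_mul_same g
    have htrace (x : Matrix n n ℝ) : (u * (g * x * gᵀ)).trace = (gᵀ * u * g * x).trace := by
      rw [← Matrix.mul_assoc, Matrix.trace_mul_comm]
      simp only [Matrix.mul_assoc]
    rw [lintegral_map (measurable_exp_neg_trace_mul_symMatrix u) hq.measurable]
    simp_rw [symMatrix_congrCoords, htrace]
    rw [hμ.laplace _ hu', det_one_add_congruence,
      trace_mul_inv_one_add_congruence g (det_one_add_mul_pos_of_posSemidef hσ hu').ne']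

theorem exists_diagonal_comp {l : n → ℝ} (hμ : IsWishartCoords p (Matrix.diagonal l) 1 μ)
    (e : m ≃ n) : ∃ ν, IsWishartCoords p (Matrix.diagonal (l ∘ e)) 1 ν := by
  let g : Matrix m n ℝ := (1 : Matrix n n ℝ).submatrix e (Equiv.refl n)
  have hg (x : Matrix n n ℝ) : g * x * gᵀ = x.submatrix e e := by
    rw [Matrix.transpose_submatrix, Matrix.transpose_one, Matrix.one_submatrix_mul,
      Matrix.mul_submatrix_one]
    rfl
  have hone : g * gᵀ = 1 := by simpa using hg 1
  have h := hμ.map_congrCoords .one hone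
  rw [hg, hg, Matrix.submatrix_diagonal_equiv, Matrix.submatrix_one_equiv] at h
  exact ⟨_, h⟩

end IsWishartCoords

end WishartCoords

section RankOneUpdate

variable {n : Type*} [Fintype n] [DecidableEq n]

theorem measurable_dotProduct_inv_mulVec {Z : Type*} [TopologicalSpace Z] [MeasurableSpace Z]
    [OpensMeasurableSpace Z] {a : Z → Matrix n n ℝ} {x y : Z → n → ℝ} (ha : Continuous a)
    (hx : Continuous x) (hy : Continuous y) : Measurable fun z => x z ⬝ᵥ (a z)⁻¹ *ᵥ y z := by
  simp_rw [Matrix.inv_def, Ring.inverse_eq_inv', Matrix.smul_mulVec, dotProduct_smul, smul_eq_mul]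
  exact ha.matrix_det.measurable.inv.mul
    (hx.dotProduct (ha.matrix_adjugate.matrix_mulVec hy)).measurable

theorem measurable_gaussianDensity {Z : Type*} [TopologicalSpace Z] [MeasurableSpace Z]
    [OpensMeasurableSpace Z] {a : Z → Matrix n n ℝ} {m y : Z → n → ℝ} (ha : Continuous a)
    (hm : Continuous m) (hy : Continuous y) :
    Measurable fun z => gaussianDensity (a z) (m z) (y z) :=
  ((measurable_const.mul (Real.continuous_sqrt.comp ha.matrix_det).measurable.inv).mul
    (measurable_dotProduct_inv_mulVec ha (hy.sub hm) (hy.sub hm)).neg.exp).ennreal_ofReal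

/-- The joint law of `(w, S + w wᵀ)`, where `S` has law `μ` and `w` is an independent centred
Gaussian vector with covariance matrix `1 / 2`. -/
noncomputable def rankOneUpdate (μ : Measure (Sym2 n → ℝ)) : Measure ((n → ℝ) × (Sym2 n → ℝ)) :=
  (((volume : Measure (n → ℝ)).withDensity (gaussianDensity 1 0)).prod μ).map fun z =>
    (z.1, z.2 + symCoords (Matrix.vecMulVec z.1 z.1))

omit [Fintype n] [DecidableEq n] in
theorem symMatrix_add_symCoords_vecMulVec (v : Sym2 n → ℝ) (w : n → ℝ) :
    symMatrix (v + symCoords (Matrix.vecMulVec w w)) = symMatrix v + Matrix.vecMulVec w w := by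
  rw [map_add, symMatrix_symCoords (Matrix.transpose_vecMulVec w w)]

omit [Fintype n] [DecidableEq n] in
theorem continuous_add_symCoords_vecMulVec :
    Continuous fun z : (n → ℝ) × (Sym2 n → ℝ) => z.2 + symCoords (Matrix.vecMulVec z.1 z.1) :=
  continuous_snd.add (continuous_symCoords.comp (continuous_fst.matrix_vecMulVec continuous_fst))

omit [DecidableEq n] in
theorem measurable_exp_neg_trace_mul_symMatrix_add_dotProduct (v : Matrix n n ℝ) (k : n → ℝ) :
    Measurable fun z : (n → ℝ) × (Sym2 n → ℝ) =>
      ENNReal.ofReal (Real.exp (-((v * symMatrix z.2).trace + 2 * (k ⬝ᵥ z.1)))) :=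
  (Real.continuous_exp.comp ((continuous_const.matrix_mul
    (continuous_symMatrix.comp continuous_snd)).matrix_trace.add
      (continuous_const.mul (continuous_const.dotProduct continuous_fst))).neg).measurable
    |>.ennreal_ofReal

variable {p : ℝ} {ω : Matrix n n ℝ} {μ : Measure (Sym2 n → ℝ)}

theorem rankOneUpdate_absolutelyContinuous (hμ : μ ≪ volume) :
    rankOneUpdate μ ≪ volume := by
  have hshear : MeasurePreserving
      (fun z : (n → ℝ) × (Sym2 n → ℝ) => (z.1, z.2 + symCoords (Matrix.vecMulVec z.1 z.1)))
      volume volume :=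
    (MeasurePreserving.id volume).skew_product
      (g := fun w v => v + symCoords (Matrix.vecMulVec w w))
      continuous_add_symCoords_vecMulVec.measurable
      (.of_forall fun w => map_add_right_eq_self volume _)
  exact (((withDensity_absolutelyContinuous _ _).prod hμ).map hshear.measurable).trans
    hshear.map_eq.absolutelyContinuous

theorem ae_rankOneUpdate (hμ : ∀ᵐ v ∂μ, (symMatrix v).PosDef) :
    ∀ᵐ z ∂rankOneUpdate μ, (symMatrix z.2).PosDef ∧ z.1 ⬝ᵥ (symMatrix z.2)⁻¹ *ᵥ z.1 ≤ 1 := by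
  have hset : MeasurableSet {z : (n → ℝ) × (Sym2 n → ℝ) |
      (symMatrix z.2).PosDef ∧ z.1 ⬝ᵥ (symMatrix z.2)⁻¹ *ᵥ z.1 ≤ 1} :=
    (measurable_snd measurableSet_setOf_symMatrix_posDef).inter (measurableSet_le
      (measurable_dotProduct_inv_mulVec (continuous_symMatrix.comp continuous_snd) continuous_fst
        continuous_fst) measurable_const)
  rw [rankOneUpdate, ae_map_iff
    (continuous_fst.prodMk continuous_add_symCoords_vecMulVec).measurable.aemeasurable hset]
  filter_upwards [Measure.quasiMeasurePreserving_snd.ae hμ] with z hz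
  rw [symMatrix_add_symCoords_vecMulVec]
  exact ⟨hz.add_posSemidef (posSemidef_vecMulVec_self z.1), dotProduct_inv_mulVec_le_one hz z.1⟩

theorem lintegral_rankOneUpdate (hμ : IsWishartCoords (p - 1 / 2) ω 1 μ) {v : Matrix n n ℝ}
    (hv : v.PosSemidef) (k : n → ℝ) :
    ∫⁻ z, ENNReal.ofReal (Real.exp (-((v * symMatrix z.2).trace + 2 * (k ⬝ᵥ z.1))))
        ∂rankOneUpdate μ =
      ENNReal.ofReal ((1 + v).det ^ (-p) *
        Real.exp (k ⬝ᵥ (1 + v)⁻¹ *ᵥ k - (v * (1 + v)⁻¹ * ω).trace)) := by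
  have := hμ.isProbabilityMeasure
  have hdet : 0 < (1 + v).det := (Matrix.PosDef.one.add_posSemidef hv).det_pos
  have htrace (w : n → ℝ) (x : Matrix n n ℝ) :
      -((v * (x + Matrix.vecMulVec w w)).trace + 2 * (k ⬝ᵥ w)) =
        -(w ⬝ᵥ v *ᵥ w + 2 * (k ⬝ᵥ w)) + -(v * x).trace := by
    rw [Matrix.mul_add, Matrix.trace_add, Matrix.mul_vecMulVec, Matrix.trace_vecMulVec,
      dotProduct_comm (v *ᵥ w)]
    ring
  have hgauss : Measurable (gaussianDensity (1 : Matrix n n ℝ) 0) :=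
    measurable_gaussianDensity continuous_const continuous_const continuous_id
  have hexp : Measurable fun w : n → ℝ =>
      ENNReal.ofReal (Real.exp (-(w ⬝ᵥ v *ᵥ w + 2 * (k ⬝ᵥ w)))) :=
    (Continuous.measurable (by fun_prop)).ennreal_ofReal
  have hpow : (√(1 + v).det)⁻¹ * (1 + v).det ^ (-(p - 1 / 2)) = (1 + v).det ^ (-p) := by
    rw [Real.sqrt_eq_rpow, ← Real.rpow_neg hdet.le, ← Real.rpow_add hdet]
    ring_nf
  rw [rankOneUpdate, lintegral_map ?_
    (continuous_fst.prodMk continuous_add_symCoords_vecMulVec).measurable]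
  · simp_rw [symMatrix_add_symCoords_vecMulVec, htrace, Real.exp_add,
      ENNReal.ofReal_mul (Real.exp_pos _).le]
    rw [lintegral_prod_mul hexp.aemeasurable
      (measurable_exp_neg_trace_mul_symMatrix v).aemeasurable,
      lintegral_withDensity_eq_lintegral_mul _ hgauss hexp]
    simp only [Pi.mul_apply]
    rw [lintegral_gaussianDensity_one_mul_exp hv, hμ.laplace v hv, Matrix.one_mul,
      ← ENNReal.ofReal_mul (by positivity), mul_mul_mul_comm, hpow, ← Real.exp_add, sub_eq_add_neg]
  · exact measurable_exp_neg_trace_mul_symMatrix_add_dotProduct v k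

end RankOneUpdate

section Border

variable {n : Type*} [Fintype n] [DecidableEq n]

/-- The joint density of the off-diagonal block `b` and the Schur complement `s` of a bordered
non-central Wishart matrix, given its upper left block `a` and the vector `w`.

It comes from the following model. Let `X = Y Yᵀ` where the columns of `Y` are independent Gaussian
vectors and the mean `m` of its last row `y` is orthogonal to the means of the other rows `Y'`. Then
`w = Y' m / |m|` is a centred Gaussian vector, independent of the Wishart matrix `Y' Y'ᵀ - w wᵀ`.
Given `Y'`, the off-diagonal block `b = Y' y` of `X` is Gaussian with mean `√l w`, where `l = |m|²`,
and covariance `a / 2` for `a = Y' Y'ᵀ`. The Schur complement `s` is the squared length of the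
projection of `y` to the complement of the row space of `Y'`; it is independent of `b`, and the
squared length of the mean of this projection is `l (1 - wᵀ a⁻¹ w)`. -/
noncomputable def borderDensity (q l : ℝ) (a : Matrix n n ℝ) (w b : n → ℝ) (s : ℝ) : ℝ≥0∞ :=
  gaussianDensity a (√l • w) b * noncentralGammaPDF q (l * (1 - w ⬝ᵥ a⁻¹ *ᵥ w)) s

/-- The coordinates of the bordered matrix with upper left block `a`, off-diagonal block `b` and
Schur complement `s`, as a function of `(((w, a), b), s)`. -/
noncomputable def borderMap (z : (((n → ℝ) × (Sym2 n → ℝ)) × (n → ℝ)) × ℝ) :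
    Sym2 (n ⊕ Unit) → ℝ :=
  borderedCoords ((z.1.1.2, z.1.2), z.1.2 ⬝ᵥ (symMatrix z.1.1.2)⁻¹ *ᵥ z.1.2 + z.2)

/-- The law of the bordered matrix whose border has the density `borderDensity q l`, when `κ` is the
joint law of `w` and `a`. -/
noncomputable def borderLaw (q l : ℝ) (κ : Measure ((n → ℝ) × (Sym2 n → ℝ))) :
    Measure (Sym2 (n ⊕ Unit) → ℝ) :=
  (((κ.prod (volume : Measure (n → ℝ))).prod (volume : Measure ℝ)).withDensity fun z =>
    borderDensity q l (symMatrix z.1.1.2) z.1.1.1 z.1.2 z.2).map borderMap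

theorem measurable_borderDensity (q l : ℝ) :
    Measurable fun z : (((n → ℝ) × (Sym2 n → ℝ)) × (n → ℝ)) × ℝ =>
      borderDensity q l (symMatrix z.1.1.2) z.1.1.1 z.1.2 z.2 := by
  have ha : Continuous fun z : (((n → ℝ) × (Sym2 n → ℝ)) × (n → ℝ)) × ℝ => symMatrix z.1.1.2 :=
    continuous_symMatrix.comp (by fun_prop)
  exact (measurable_gaussianDensity ha (by fun_prop) (by fun_prop)).mul
    ((measurable_noncentralGammaPDF q).comp
      (((measurable_dotProduct_inv_mulVec ha (by fun_prop) (by fun_prop)).const_sub 1).const_mul l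
        |>.prodMk measurable_snd))

theorem quasiMeasurePreserving_borderMap :
    Measure.QuasiMeasurePreserving (borderMap (n := n)) := by
  have hm : Measurable fun z : (Sym2 n → ℝ) × (n → ℝ) => z.2 ⬝ᵥ (symMatrix z.1)⁻¹ *ᵥ z.2 :=
    measurable_dotProduct_inv_mulVec (continuous_symMatrix.comp continuous_fst) continuous_snd
      continuous_snd
  have hshear : MeasurePreserving (fun z : ((Sym2 n → ℝ) × (n → ℝ)) × ℝ =>
      (z.1, z.1.2 ⬝ᵥ (symMatrix z.1.1)⁻¹ *ᵥ z.1.2 + z.2)) volume volume :=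
    MeasurePreserving.skew_product (μc := (volume : Measure ℝ)) (μd := volume)
      (MeasurePreserving.id _)
      (g := fun (z : (Sym2 n → ℝ) × (n → ℝ)) s => z.2 ⬝ᵥ (symMatrix z.1)⁻¹ *ᵥ z.2 + s)
      ((hm.comp measurable_fst).add measurable_snd)
      (.of_forall fun z => map_add_left_eq_self volume _)
  have hproj : Measure.QuasiMeasurePreserving
      (fun z : (((n → ℝ) × (Sym2 n → ℝ)) × (n → ℝ)) × ℝ => ((z.1.1.2, z.1.2), z.2)) :=
    QuasiMeasurePreserving.prodMap (QuasiMeasurePreserving.prodMap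
      Measure.quasiMeasurePreserving_snd (.id volume)) (.id volume)
  have : (volume : Measure ((Sym2 n → ℝ) × (n → ℝ))).IsAddHaarMeasure :=
    Measure.prod.instIsAddHaarMeasure _ _
  have : (volume : Measure (((Sym2 n → ℝ) × (n → ℝ)) × ℝ)).IsAddHaarMeasure :=
    Measure.prod.instIsAddHaarMeasure _ _
  exact (quasiMeasurePreserving_of_surjective _ surjective_borderedCoords volume volume).comp
    (hshear.quasiMeasurePreserving.comp hproj)

variable {κ : Measure ((n → ℝ) × (Sym2 n → ℝ))}

theorem borderLaw_absolutelyContinuous (q l : ℝ) (hκ : κ ≪ volume) :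
    borderLaw q l κ ≪ volume :=
  (((withDensity_absolutelyContinuous _ _).trans ((hκ.prod .rfl).prod .rfl)).map
    quasiMeasurePreserving_borderMap.measurable).trans
    quasiMeasurePreserving_borderMap.absolutelyContinuous

theorem ae_borderLaw_posDef (q l : ℝ) (hκ : ∀ᵐ z ∂κ, (symMatrix z.2).PosDef) :
    ∀ᵐ v ∂borderLaw q l κ, (symMatrix v).PosDef := by
  have hne : ∀ᵐ s : ℝ, s ≠ 0 := by simp [ae_iff]
  rw [borderLaw, ae_map_iff quasiMeasurePreserving_borderMap.measurable.aemeasurable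
    measurableSet_setOf_symMatrix_posDef, ae_withDensity_iff (measurable_borderDensity q l)]
  filter_upwards [(Measure.quasiMeasurePreserving_fst.comp
    Measure.quasiMeasurePreserving_fst).ae hκ, Measure.quasiMeasurePreserving_snd.ae hne]
    with ⟨⟨⟨w, a⟩, b⟩, s⟩ ha hs hdensity
  rw [borderMap, symMatrix_borderedCoords]
  refine borderedMatrix_posDef ha b (lt_of_le_of_ne (not_lt.1 fun hneg => hdensity ?_) hs.symm)
  rw [borderDensity, noncentralGammaPDF_of_neg _ _ hneg, mul_zero]

theorem trace_borderedMatrix_mul_schur (v a : Matrix n n ℝ) (k b : n → ℝ) (h s : ℝ) :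
    (borderedMatrix (v + (1 + h)⁻¹ • Matrix.vecMulVec k k) k h *
        borderedMatrix a b (b ⬝ᵥ a⁻¹ *ᵥ b + s)).trace =
      (v * a).trace + (1 + h)⁻¹ * (k ⬝ᵥ a *ᵥ k) + (h * (b ⬝ᵥ a⁻¹ *ᵥ b) + 2 * (k ⬝ᵥ b)) + h * s := by
  rw [trace_borderedMatrix_mul, Matrix.add_mul, Matrix.trace_add, Matrix.smul_mul,
    Matrix.trace_smul, Matrix.vecMulVec_mul, Matrix.trace_vecMulVec, dotProduct_comm k (k ᵥ* a),
    ← Matrix.dotProduct_mulVec, smul_eq_mul]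
  ring

theorem rpow_neg_add_natCast_div_two {x : ℝ} (hx : 0 < x) (q : ℝ) (k : ℕ) :
    x ^ (-(q + k / 2)) = (√x ^ k)⁻¹ * x ^ (-q) := by
  rw [Real.sqrt_eq_rpow, ← Real.rpow_mul_natCast hx.le, ← Real.rpow_neg hx.le, ← Real.rpow_add hx]
  ring_nf

theorem lintegral_borderDensity_mul_exp {q l h : ℝ} (hq : 0 < q) (hl : 0 ≤ l) (hh : 0 < 1 + h)
    {a : Matrix n n ℝ} (ha : a.PosDef) {w : n → ℝ} (hw : w ⬝ᵥ a⁻¹ *ᵥ w ≤ 1) (v : Matrix n n ℝ)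
    (k : n → ℝ) :
    ∫⁻ b, ∫⁻ s, borderDensity q l a w b s * ENNReal.ofReal (Real.exp
        (-(borderedMatrix (v + (1 + h)⁻¹ • Matrix.vecMulVec k k) k h *
          borderedMatrix a b (b ⬝ᵥ a⁻¹ *ᵥ b + s)).trace)) =
      ENNReal.ofReal ((1 + h) ^ (-(q + Fintype.card n / 2)) * Real.exp (-(h / (1 + h) * l))) *
        ENNReal.ofReal (Real.exp (-((v * a).trace + 2 * ((√l / (1 + h)) • k ⬝ᵥ w)))) := by
  have hexp : -((v * a).trace + (1 + h)⁻¹ * (k ⬝ᵥ a *ᵥ k)) +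
      ((1 + h)⁻¹ * (k ⬝ᵥ a *ᵥ k - 2 * (k ⬝ᵥ √l • w) - h * (√l • w ⬝ᵥ a⁻¹ *ᵥ √l • w)) +
        -(h / (1 + h) * (l * (1 - w ⬝ᵥ a⁻¹ *ᵥ w)))) =
      -(h / (1 + h) * l) + -((v * a).trace + 2 * ((√l / (1 + h)) • k ⬝ᵥ w)) := by
    simp only [dotProduct_smul, smul_dotProduct, Matrix.mulVec_smul, smul_eq_mul]
    linear_combination (-h * (1 + h)⁻¹ * (w ⬝ᵥ a⁻¹ *ᵥ w)) * Real.mul_self_sqrt hl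
  have hgauss : Measurable fun b : n → ℝ => gaussianDensity a (√l • w) b *
      ENNReal.ofReal (Real.exp (-(h * (b ⬝ᵥ a⁻¹ *ᵥ b) + 2 * (k ⬝ᵥ b)))) :=
    (measurable_gaussianDensity continuous_const continuous_const continuous_id).fun_mul
      (by fun_prop)
  have hgamma : Measurable fun s => noncentralGammaPDF q (l * (1 - w ⬝ᵥ a⁻¹ *ᵥ w)) s *
      ENNReal.ofReal (Real.exp (-(h * s))) :=
    ((measurable_noncentralGammaPDF q).comp measurable_prodMk_left).fun_mul (by fun_prop)
  simp_rw [trace_borderedMatrix_mul_schur, borderDensity, neg_add _ (h * _),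
    neg_add _ (_ + (2 : ℝ) * _), Real.exp_add,
    ENNReal.ofReal_mul (mul_pos (Real.exp_pos _) (Real.exp_pos _)).le,
    ENNReal.ofReal_mul (Real.exp_pos _).le]
  calc _ = ENNReal.ofReal (Real.exp (-((v * a).trace + (1 + h)⁻¹ * (k ⬝ᵥ a *ᵥ k)))) *
        ((∫⁻ b, gaussianDensity a (√l • w) b *
          ENNReal.ofReal (Real.exp (-(h * (b ⬝ᵥ a⁻¹ *ᵥ b) + 2 * (k ⬝ᵥ b))))) *
        ∫⁻ s, noncentralGammaPDF q (l * (1 - w ⬝ᵥ a⁻¹ *ᵥ w)) s *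
          ENNReal.ofReal (Real.exp (-(h * s)))) := by
        rw [← lintegral_mul_const _ hgauss, ← lintegral_const_mul _ (hgauss.mul_const _)]
        congr 1 with b
        rw [← lintegral_const_mul _ hgamma, ← lintegral_const_mul _ (hgamma.const_mul _)]
        congr 1 with s
        ring
    _ = _ := by
        rw [lintegral_gaussianDensity_mul_exp ha _ _ hh,
          lintegral_noncentralGammaPDF_mul_exp hq (mul_nonneg hl (sub_nonneg.2 hw)) hh,
          rpow_neg_add_natCast_div_two hh,
          ← ENNReal.ofReal_mul (by positivity), ← ENNReal.ofReal_mul (by positivity),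
          ← ENNReal.ofReal_mul (by positivity), mul_mul_mul_comm, ← Real.exp_add,
          mul_left_comm, ← Real.exp_add, hexp, Real.exp_add]
        simp only [mul_assoc]

theorem lintegral_borderLaw (q l : ℝ) (u : Matrix (n ⊕ Unit) (n ⊕ Unit) ℝ) :
    ∫⁻ v, ENNReal.ofReal (Real.exp (-(u * symMatrix v).trace)) ∂borderLaw q l κ =
      ∫⁻ y, ∫⁻ b, ∫⁻ s, borderDensity q l (symMatrix y.2) y.1 b s * ENNReal.ofReal (Real.exp
        (-(u * borderedMatrix (symMatrix y.2) b
          (b ⬝ᵥ (symMatrix y.2)⁻¹ *ᵥ b + s)).trace)) ∂volume ∂volume ∂κ := by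
  have hmap := (quasiMeasurePreserving_borderMap (n := n)).measurable
  have hexp := measurable_exp_neg_trace_mul_symMatrix u
  have hcomp : Measurable fun z => ENNReal.ofReal (Real.exp
      (-(u * symMatrix (borderMap (n := n) z)).trace)) := hexp.comp hmap
  have hmul := (measurable_borderDensity (n := n) q l).mul hcomp
  rw [borderLaw, lintegral_map hexp hmap,
    lintegral_withDensity_eq_lintegral_mul _ (measurable_borderDensity q l) hcomp,
    lintegral_prod _ hmul.aemeasurable, lintegral_prod _ hmul.lintegral_prod_right'.aemeasurable]
  simp only [Pi.mul_apply, borderMap, symMatrix_borderedCoords]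

theorem IsWishartCoords.borderLaw_rankOneUpdate {p l : ℝ} {ω : Matrix n n ℝ}
    {μ : Measure (Sym2 n → ℝ)} (hμ : IsWishartCoords (p - 1 / 2) ω 1 μ)
    (hp : Fintype.card n / 2 < p) (hl : 0 ≤ l) :
    IsWishartCoords p (borderedMatrix ω 0 l) 1
      (borderLaw (p - Fintype.card n / 2) l (rankOneUpdate μ)) := by
  have hae := ae_rankOneUpdate hμ.posDef
  refine ⟨borderLaw_absolutelyContinuous _ _
      (rankOneUpdate_absolutelyContinuous hμ.absolutelyContinuous),
    ae_borderLaw_posDef _ _ (hae.mono fun _ hz => hz.1), fun u hu => ?_⟩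
  obtain ⟨v, k, h, hv, hh, rfl⟩ := exists_eq_borderedMatrix_of_posSemidef hu
  have hpos : 0 < 1 + h := by positivity
  have hdet : 0 < (1 + v).det := (Matrix.PosDef.one.add_posSemidef hv).det_pos
  have hexp : -(h / (1 + h) * l) + ((√l / (1 + h)) • k ⬝ᵥ (1 + v)⁻¹ *ᵥ (√l / (1 + h)) • k -
      (v * (1 + v)⁻¹ * ω).trace) = -((v * (1 + v)⁻¹ * ω).trace +
        l * (h / (1 + h) - (1 + h)⁻¹ ^ 2 * (k ⬝ᵥ (1 + v)⁻¹ *ᵥ k))) := by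
    simp only [dotProduct_smul, smul_dotProduct, Matrix.mulVec_smul, smul_eq_mul]
    linear_combination ((1 + h)⁻¹ ^ 2 * (k ⬝ᵥ (1 + v)⁻¹ *ᵥ k)) * Real.mul_self_sqrt hl
  rw [lintegral_borderLaw, lintegral_congr_ae (hae.mono fun z hz =>
      lintegral_borderDensity_mul_exp (sub_pos.2 hp) hl hpos hz.1 hz.2 v k),
    lintegral_const_mul _ (measurable_exp_neg_trace_mul_symMatrix_add_dotProduct v _),
    lintegral_rankOneUpdate hμ hv, Matrix.one_mul,
    det_one_add_borderedMatrix k hpos.ne', trace_mul_inv_one_add_borderedMatrix hv k hpos.ne' hu,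
    ← ENNReal.ofReal_mul (by positivity), Real.mul_rpow hpos.le hdet.le, mul_mul_mul_comm,
    ← Real.exp_add, hexp, sub_add_cancel]

end Border

section Existence

theorem isWishartCoords_of_isEmpty {n : Type*} [IsEmpty n] [Fintype n] [DecidableEq n] (p : ℝ)
    (ω σ : Matrix n n ℝ) : IsWishartCoords p ω σ volume := by
  have : IsEmpty (Sym2 n) := ⟨Sym2.ind fun i => isEmptyElim i⟩
  have : IsProbabilityMeasure (volume : Measure (Sym2 n → ℝ)) :=
    by rw [volume_pi, Measure.pi_of_empty _ isEmptyElim]; infer_instance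
  refine ⟨.rfl, .of_forall fun v => ?_, fun u _ => ?_⟩
  · rw [Subsingleton.elim (symMatrix v) 1]
    exact .one
  · simp [Matrix.trace]

theorem borderedMatrix_diagonal {n : Type*} [DecidableEq n] (l : n → ℝ) (c : ℝ) :
    borderedMatrix (Matrix.diagonal l) 0 c = Matrix.diagonal (Sum.elim l fun _ => c) := by
  rw [borderedMatrix, Matrix.replicateCol_zero, Matrix.replicateRow_zero,
    Matrix.fromBlocks_diagonal]

theorem exists_isWishartCoords_diagonal {n : Type*} [Fintype n] [DecidableEq n] {p : ℝ}
    (hp : ((Fintype.card n : ℝ) - 1) / 2 < p) {l : n → ℝ} (hl : ∀ i, 0 ≤ l i) :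
    ∃ μ, IsWishartCoords p (Matrix.diagonal l) 1 μ := by
  refine Finite.induction_empty_option (P := fun n => ∀ [Fintype n] [DecidableEq n] {p : ℝ},
    ((Fintype.card n : ℝ) - 1) / 2 < p → ∀ {l : n → ℝ}, (∀ i, 0 ≤ l i) →
      ∃ μ, IsWishartCoords p (Matrix.diagonal l) 1 μ) ?_ ?_ ?_ n hp hl
  · intro m n e ih _ _ p hp l hl
    let _ := Fintype.ofEquiv n e.symm
    let _ := e.decidableEq
    obtain ⟨μ, hμ⟩ := ih (by rwa [Fintype.card_congr e]) fun i => hl (e i)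
    simpa [Function.comp_def] using hμ.exists_diagonal_comp e.symm
  · exact fun _ _ _ => ⟨_, isWishartCoords_of_isEmpty _ _ _⟩
  · intro n _ ih _ _ p hp l hl
    let _ := Classical.decEq n
    rw [Fintype.card_congr (Equiv.optionEquivSumPUnit n), Fintype.card_sum, Fintype.card_unit,
      Nat.cast_add_one, add_sub_cancel_right] at hp
    obtain ⟨μ, hμ⟩ := ih (p := p - 1 / 2) (by linarith) fun i => hl (some i)
    have hborder := hμ.borderLaw_rankOneUpdate hp (hl none)
    rw [borderedMatrix_diagonal] at hborder
    convert! hborder.exists_diagonal_comp (Equiv.optionEquivSumPUnit n) using 4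
    ext (_ | i) <;> rfl

theorem exists_isWishartCoords {n : Type*} [Fintype n] [DecidableEq n] {p : ℝ}
    (hp : ((Fintype.card n : ℝ) - 1) / 2 < p) {ω σ : Matrix n n ℝ} (hω : ω.PosSemidef)
    (hσ : σ.PosDef) : ∃ μ, IsWishartCoords p ω σ μ := by
  obtain ⟨g, h, l, hgh, hl, rfl, rfl⟩ := exists_simultaneous_diagonalization hσ hω
  obtain ⟨μ, hμ⟩ := exists_isWishartCoords_diagonal hp hl
  have := hμ.map_congrCoords .one hgh
  rw [Matrix.mul_one] at this
  exact ⟨_, this⟩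

end Existence

section OrderedCoordinates

variable {d : ℕ}

/-- The coordinates of a matrix with respect to which `symmetricOfCoords` is a parametrization of
the symmetric matrices. -/
noncomputable def orderedCoords :
    Matrix (Fin d) (Fin d) ℝ →ₗ[ℝ] ({q : Fin d × Fin d // q.1 ≤ q.2} → ℝ) where
  toFun x q := if q.1.1 = q.1.2 then x q.1.1 q.1.2 else √2 * x q.1.1 q.1.2
  map_add' x y := by
    ext q
    simp only [Matrix.add_apply, mul_add, Pi.add_apply]
    split_ifs <;> rfl
  map_smul' r x := by
    ext q
    simp only [Matrix.smul_apply, mul_smul_comm, Pi.smul_apply, RingHom.id_apply]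
    split_ifs <;> rfl

theorem isSymm_symmetricOfCoords (v : {q : Fin d × Fin d // q.1 ≤ q.2} → ℝ) :
    (symmetricOfCoords d v).IsSymm := by
  ext i j
  obtain rfl | hij := eq_or_ne i j
  · rfl
  · simp only [Matrix.transpose_apply, symmetricOfCoords, Matrix.of_apply, hij, hij.symm, if_false,
      min_comm, max_comm]

theorem orderedCoords_symmetricOfCoords (v : {q : Fin d × Fin d // q.1 ≤ q.2} → ℝ) :
    orderedCoords (symmetricOfCoords d v) = v := by
  ext ⟨⟨i, j⟩, hij : i ≤ j⟩
  change (if i = j then symmetricOfCoords d v i j else √2 * symmetricOfCoords d v i j) = _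
  obtain rfl | hne := eq_or_ne i j
  · simp only [symmetricOfCoords, Matrix.of_apply, if_true]
  · simp only [symmetricOfCoords, Matrix.of_apply, hne, if_false, min_eq_left hij,
      max_eq_right hij]
    exact mul_div_cancel₀ _ (Real.sqrt_ne_zero'.2 two_pos)

theorem symmetricOfCoords_orderedCoords {x : Matrix (Fin d) (Fin d) ℝ} (hx : x.IsSymm) :
    symmetricOfCoords d (orderedCoords x) = x := by
  ext i j
  obtain rfl | hne := eq_or_ne i j
  · simp only [symmetricOfCoords, orderedCoords, LinearMap.coe_mk, AddHom.coe_mk, Matrix.of_apply,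
      if_true]
  · rcases le_total i j with hij | hij
    · simp [symmetricOfCoords, orderedCoords, hne, hij]
    · simp [symmetricOfCoords, orderedCoords, hne, hij, hx.apply i j]

theorem measurableEmbedding_symmetricOfCoords (d : ℕ) :
    MeasurableEmbedding (symmetricOfCoords d) := by
  have hcont : Continuous (symmetricOfCoords d) := continuous_matrix fun i j => by
    unfold symmetricOfCoords
    obtain rfl | hne := eq_or_ne i j
    · simpa only [Matrix.of_apply, if_true] using continuous_apply _
    · simpa only [Matrix.of_apply, hne, if_false] using (continuous_apply _).div_const _
  exact hcont.measurableEmbedding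
    (Function.LeftInverse.injective orderedCoords_symmetricOfCoords)

theorem measurableEmbedding_symMatrix (d : ℕ) :
    MeasurableEmbedding (symMatrix : (Sym2 (Fin d) → ℝ) →ₗ[ℝ] Matrix (Fin d) (Fin d) ℝ) :=
  continuous_symMatrix.measurableEmbedding (Function.LeftInverse.injective symCoords_symMatrix)

theorem map_symMatrix_absolutelyContinuous {μ : Measure (Sym2 (Fin d) → ℝ)} (hμ : μ ≪ volume) :
    μ.map symMatrix ≪
      (volume : Measure ({q : Fin d × Fin d // q.1 ≤ q.2} → ℝ)).map (symmetricOfCoords d) := by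
  have hsurj : Function.Surjective (orderedCoords ∘ₗ symMatrix (n := Fin d)) := fun w =>
    ⟨symCoords (symmetricOfCoords d w), by
      rw [LinearMap.comp_apply, symMatrix_symCoords (isSymm_symmetricOfCoords w),
        orderedCoords_symmetricOfCoords]⟩
  have hq := quasiMeasurePreserving_of_surjective _ hsurj volume volume
  have hcomp : symmetricOfCoords d ∘ (orderedCoords ∘ₗ symMatrix) = symMatrix :=
    funext fun v => symmetricOfCoords_orderedCoords (isSymm_symMatrix v)
  have hmeas := (measurableEmbedding_symmetricOfCoords d).measurable
  rw [← hcomp, ← Measure.map_map hmeas hq.measurable]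
  exact ((hμ.map hq.measurable).trans hq.absolutelyContinuous).map hmeas

end OrderedCoordinates

section Cone

variable {d : ℕ}

theorem measurableEmbedding_psdCone_val :
    MeasurableEmbedding (Subtype.val : PSDCone d → Matrix (Fin d) (Fin d) ℝ) :=
  MeasurableEmbedding.subtype_coe isClosed_setOf_posSemidef.measurableSet

instance sigmaFinite_lebesgueCone : SigmaFinite (lebesgueCone d) := by
  have := (measurableEmbedding_symmetricOfCoords d).sigmaFinite_map (μ := volume)
  refine .of_map _ measurableEmbedding_psdCone_val.measurable.aemeasurable ?_
  rw [lebesgueCone, measurableEmbedding_psdCone_val.map_comap]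
  infer_instance

theorem isNoncentralWishart_of_lintegral {p : ℝ} {ω σ : PSDCone d} {ν : Measure (PSDCone d)}
    (h : ∀ u : PSDCone d, ∫⁻ ξ, ENNReal.ofReal (Real.exp (-(u.pairing ξ))) ∂ν =
      ENNReal.ofReal ((1 + σ.1 * u.1).det ^ (-p) *
        Real.exp (-(u.1 * (1 + σ.1 * u.1)⁻¹ * ω.1).trace))) :
    IsNoncentralWishart p ω σ ν where
  isProbabilityMeasure :=
    ⟨by simpa [PSDCone.pairing] using h ⟨0, Matrix.PosSemidef.zero⟩⟩
  laplace u := by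
    rw [integral_eq_lintegral_of_nonneg_ae (.of_forall fun _ => (Real.exp_pos _).le)
      (PSDCone.expNegPairing u).continuous.aestronglyMeasurable, h, ENNReal.toReal_ofReal]
    have := det_one_add_mul_pos_of_posSemidef σ.2 u.2
    positivity

theorem exists_isNoncentralWishart_absolutelyContinuous {p : ℝ} (hp : ((d : ℝ) - 1) / 2 < p)
    (ω : PSDCone d) {σ : PSDCone d} (hσ : σ.1.PosDef) :
    ∃ ν, IsNoncentralWishart p ω σ ν ∧ ν ≪ lebesgueCone d := by
  obtain ⟨μ, hμ⟩ := exists_isWishartCoords (p := p) (by rwa [Fintype.card_fin]) ω.2 hσ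
  have hval := measurableEmbedding_psdCone_val (d := d)
  have hsym := measurableEmbedding_symMatrix d
  let ν : Measure (PSDCone d) := (μ.map symMatrix).comap Subtype.val
  have hmap : ν.map Subtype.val = μ.map symMatrix := by
    rw [hval.map_comap]
    refine Measure.restrict_eq_self_of_ae_mem (hsym.ae_map_iff.2 ?_)
    filter_upwards [hμ.posDef] with v hv
    exact ⟨⟨_, hv.posSemidef⟩, rfl⟩
  refine ⟨ν, isNoncentralWishart_of_lintegral fun u => ?_, fun s hs => ?_⟩
  · rw [← hμ.laplace u.1 u.2]
    have h := hval.lintegral_map (μ := ν)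
      (fun x => ENNReal.ofReal (Real.exp (-(u.1 * x).trace)))
    rw [hmap, hsym.lintegral_map] at h
    exact h.symm
  · rw [lebesgueCone, hval.comap_apply] at hs
    rw [hval.comap_apply]
    exact map_symMatrix_absolutelyContinuous hμ.absolutelyContinuous hs

end Cone

section PositiveDefiniteScale

attribute [local instance] Matrix.linftyOpNormedRing Matrix.linftyOpNormedAlgebra

variable {d : ℕ} {x : PSDCone d}

theorem wishartFlow_posDef (β : Matrix (Fin d) (Fin d) ℝ) (t : ℝ) (hx : x.1.PosDef) :
    (wishartFlow β t x).1.PosDef := by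
  have hdet (b : Matrix (Fin d) (Fin d) ℝ) : (NormedSpace.exp b).det ≠ 0 :=
    ((Matrix.isUnit_iff_isUnit_det _).1 (Matrix.isUnit_exp b)).ne_zero
  rw [(wishartFlow β t x).2.posDef_iff_det_ne_zero]
  simp only [wishartFlow, Matrix.det_mul]
  exact mul_ne_zero (mul_ne_zero (hdet _) hx.det_pos.ne') (hdet _)

theorem wishartScale_posDef (β : Matrix (Fin d) (Fin d) ℝ) {t : ℝ≥0} (ht : 0 < t)
    (hx : x.1.PosDef) : (wishartScale β t x).1.PosDef := by
  refine Matrix.PosDef.of_dotProduct_mulVec_pos (wishartScale β t x).2.1 fun v hv => ?_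
  let Q : Matrix (Fin d) (Fin d) ℝ →ₗ[ℝ] ℝ :=
    { toFun := fun a => star v ⬝ᵥ a *ᵥ v
      map_add' := fun a b => by rw [Matrix.add_mulVec, dotProduct_add]
      map_smul' := fun r a => by rw [Matrix.smul_mulVec, dotProduct_smul, RingHom.id_apply] }
  have hderiv (s : ℝ) : HasDerivAt (fun r => Q (integratedFlow β x r))
      (Q ((2 : ℝ) • (wishartFlow β s x).1)) s :=
    Q.toContinuousLinearMap.hasFDerivAt.comp_hasDerivAt s (hasDerivAt_integratedFlow x β s)
  have hpos (s : ℝ) : 0 < Q ((2 : ℝ) • (wishartFlow β s x).1) := by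
    rw [map_smul, smul_eq_mul]
    exact mul_pos two_pos ((wishartFlow_posDef β s hx).dotProduct_mulVec_pos hv)
  have hmono : Q (integratedFlow β x 0) < Q (integratedFlow β x t) :=
    strictMono_of_hasDerivAt_pos hderiv hpos ht
  rwa [integratedFlow_zero, map_zero] at hmono

end PositiveDefiniteScale

theorem proposition7 {d : ℕ} {Ω : Type*} [mΩ : MeasurableSpace Ω]
    (ℱ : Filtration ℝ≥0 mΩ) (X : ℝ≥0 → Ω → PSDCone d) (P : PSDCone d → Measure Ω)
    (p : ℝ) (α : PSDCone d) (β : Matrix (Fin d) (Fin d) ℝ)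
    (hX : IsWishartProcess ℱ X P p α β) (hα : α.1 ≠ 0) :
    (∀ t : ℝ≥0, 0 < t → ∀ x : PSDCone d,
      IsNoncentralWishart p (wishartFlow β t x) (wishartScale β t α) ((P x).map (X t)) ∧
      (P x).map (X t) = noncentralWishart p (wishartFlow β t x) (wishartScale β t α)) ∧
    (α.1.PosDef → ((d : ℝ) - 1) / 2 < p → ∀ t : ℝ≥0, 0 < t → ∀ x : PSDCone d,
      (P x).map (X t) = (lebesgueCone d).withDensity
        fun ξ => wishartDensity p (wishartFlow β t x) (wishartScale β t α) ξ) := by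
  refine ⟨fun t _ x => ⟨hX.isNoncentralWishart t x,
    (hX.isNoncentralWishart t x).eq_noncentralWishart⟩, fun hαpos hp t ht x => ?_⟩
  obtain ⟨ν, hν, hac⟩ := exists_isNoncentralWishart_absolutelyContinuous hp (wishartFlow β t x)
    (wishartScale_posDef β ht hαpos)
  rw [(hX.isNoncentralWishart t x).unique hν]
  have := hν.isProbabilityMeasure
  unfold wishartDensity
  rw [← hν.eq_noncentralWishart]
  exact (Measure.withDensity_rnDeriv_eq ν (lebesgueCone d) hac).symm
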